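/- Let $\alpha\ge 1$, $n\ge 1$, let $\mathcal Y$ be a measurable space, let $Y_1,\dots,Y_n$ be independent $\mathcal Y$-valued random variables, $Y=(Y_1,\dots,Y_n)$, and let $Y'=(Y'_1,\dots,Y'_n)$ be an independent copy of $Y$. Let $f:\mathcal Y^n\to\mathbb R$ be measurable with $\mathbb E|f(Y)|<\infty$, and for $i=1,\dots,n$ and $y\in\mathcal Y^n$ set $$f_i(y)=f(y)-\mathbb E' f(y_1,\dots,y_{i-1},Y'_i,y_{i+1},\dots,y_n),\qquad \mathscr F_{-i}=\sigma(Y_j: j\ne i),$$ where $\mathbb E'$ is the expectation with respect to $Y'$. For a law $\nu$ on $\mathbb R$ put $\|\nu\|_{\psi_\alpha}=\inf\{t>0:\int (e^{(|s|/t)^\alpha}-1)\,d\nu(s)\le 1\}\in[0,\infty]$, and for a real random variable $X$ and a $\sigma$-algebra $\mathscr G$ let $\|X\mid\mathscr G\|_{\psi_\alpha}$ be the random variable $\omega\mapsto\|\mu_{X|\mathscr G}(\omega)\|_{\psi_\alpha}$, where $\mu_{X|\mathscr G}$ is a regular conditional distribution of $X$ given $\mathscr G$. Set $$U_i=\big\|f_i(Y)\,\big|\,\mathscr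 F_{-i}\big\|_{\psi_\alpha},\qquad \sigma_i^2=\mathbb E\big[f_i^2(Y)\,\big|\,\mathscr F_{-i}\big],$$ and let $0\le K\le U$ and $\sigma>0$ be real numbers such that almost surely $$\max_{k}U_k\le K,\qquad \sum_{k}U_k^2\le U^2,\qquad \sum_{k}\sigma_k^2\le\sigma^2 .$$ Write $\underline{\log}\,u=\max(\ln u,1)$ (with $\underline{\log}\,0=1$) and $z=\big(4\,\underline{\log}\frac{eU}{\sigma}\big)^{1/\alpha}$. Then for every $\mathrm x>0$, with probability at least $1-e^{-\mathrm x}$, $$f(Y)-\mathbb E f(Y)\le \sigma\sqrt{2\mathrm x\,\tfrac{n+1}{n}}+\frac{4Kz\mathrm x}{\min\Big\{2\alpha z^\alpha,\ \underline{\log}\Big(\Big(\frac{Kz}{\sigma\frac{n+1}{n}}\Big)^2\mathrm x\Big)\Big\}},$$ and moreover, with probability at least $1-e^{-\mathrm x}$, $$f(Y)-\mathbb E f(Y)\le \sigma\sqrt{2\mathrm x\,\tfrac{n+1}{n}}+\tfrac34\,Kz\mathrm x\,\tfrac{n+1}{n}.$$ -/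

import Mathlib

open MeasureTheory ProbabilityTheory
open scoped ENNReal

noncomputable section

namespace McDiarmid

/-- The Orlicz function `ψ_α(x) = exp(x^α) - 1` (used for `x ≥ 0`). -/
def orliczPsi (α x : ℝ) : ℝ := Real.exp (x ^ α) - 1

/-- The `ψ_α`-Orlicz norm of a law `ν` on `ℝ`, as an element of `[0, ∞]`:
`inf {t > 0 : ∫ ψ_α(|s| / t) dν(s) ≤ 1}`, with `inf ∅ = ∞`. -/
def orliczNorm (α : ℝ) (ν : Measure ℝ) : ℝ≥0∞ :=
  sInf (ENNReal.ofReal ''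
    {t : ℝ | 0 < t ∧ ∫⁻ s, ENNReal.ofReal (orliczPsi α (|s| / t)) ∂ν ≤ 1})

/-- A regular conditional distribution `μ_{X | 𝓖}` of a real random variable `X` given a
sub-`σ`-algebra `𝓖`: a `𝓖`-measurable random probability measure on `ℝ` with
`μ_{X | 𝓖}(A) = P[X ∈ A | 𝓖]` a.s. for every Borel set `A`. It is Mathlib's conditional
distribution of `X` given the identity map `(Ω, 𝓕) → (Ω, 𝓖)`. -/
def condLaw {Ω : Type*} (𝓖 : MeasurableSpace Ω) {𝓕 : MeasurableSpace Ω} (X : Ω → ℝ)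
    (P : Measure Ω) [IsFiniteMeasure P] : @Kernel Ω ℝ 𝓖 inferInstance :=
  @condDistrib Ω Ω ℝ _ _ _ 𝓕 𝓖 X id P _

/-- The conditional Orlicz norm `‖X | 𝓖‖_{ψ_α}`: the random variable sending `ω` to the
`ψ_α`-norm of the conditional distribution of `X` given `𝓖` at `ω`. -/
def condOrliczNorm {Ω : Type*} (𝓖 : MeasurableSpace Ω) {𝓕 : MeasurableSpace Ω} (α : ℝ)
    (X : Ω → ℝ) (P : Measure Ω) [IsFiniteMeasure P] (ω : Ω) : ℝ≥0∞ :=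
  orliczNorm α (condLaw 𝓖 X P ω)

/-- `𝓕_{-k} = σ(Y_j : j ≠ k)`. -/
abbrev sigmaWithout {Ω 𝒴 : Type*} [MeasurableSpace 𝒴] {n : ℕ} (Y : Fin n → Ω → 𝒴) (k : Fin n) :
    MeasurableSpace Ω :=
  ⨆ j : Fin n, ⨆ _ : j ≠ k, MeasurableSpace.comap (Y j) inferInstance

/-- `f_i(y) = f(y) - E' f(y_1, …, y_{i-1}, Y'_i, y_{i+1}, …, y_n)`, where `law` is the law of the
random vector `Y' = (Y'_1, …, Y'_n)`. -/
def centered {𝒴 : Type*} [MeasurableSpace 𝒴] {n : ℕ} (f : (Fin n → 𝒴) → ℝ)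
    (law : Measure (Fin n → 𝒴)) (i : Fin n) (y : Fin n → 𝒴) : ℝ :=
  f y - ∫ y', f (Function.update y i (y' i)) ∂law

/-- The random variable `f_i(Y)`, for `Y'` an independent copy of `Y = (Y_1, …, Y_n)` under `P`. -/
def diffVar {Ω 𝒴 : Type*} [MeasurableSpace Ω] [MeasurableSpace 𝒴] {n : ℕ} (P : Measure Ω)
    (Y : Fin n → Ω → 𝒴) (f : (Fin n → 𝒴) → ℝ) (i : Fin n) (ω : Ω) : ℝ :=
  centered f (P.map (fun ω' j => Y j ω')) i (fun j => Y j ω)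

/-- The random variable `U_i = ‖f_i(Y) | 𝓕_{-i}‖_{ψ_α}`. -/
def diffOrlicz {Ω 𝒴 : Type*} [MeasurableSpace Ω] [MeasurableSpace 𝒴] {n : ℕ} (P : Measure Ω)
    [IsFiniteMeasure P] (α : ℝ) (Y : Fin n → Ω → 𝒴) (f : (Fin n → 𝒴) → ℝ) (i : Fin n) (ω : Ω) :
    ℝ≥0∞ :=
  condOrliczNorm (sigmaWithout Y i) α (diffVar P Y f i) P ω

/-- The random variable `σ_i² = E[f_i(Y)² | 𝓕_{-i}]`. -/
def diffVariance {Ω 𝒴 : Type*} [MeasurableSpace Ω] [MeasurableSpace 𝒴] {n : ℕ} (P : Measure Ω)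
    (Y : Fin n → Ω → 𝒴) (f : (Fin n → 𝒴) → ℝ) (i : Fin n) : Ω → ℝ :=
  P[fun ω => diffVar P Y f i ω ^ 2 | sigmaWithout Y i]

/-- `log̲ x = max(ln x, 1)`. -/
def ulog (x : ℝ) : ℝ := max (Real.log x) 1

/-- `z = z(U, σ; α) = (4 log̲(e U / σ))^{1/α}`, in the range `α ≥ 1`. -/
def zParam (U σ α : ℝ) : ℝ := (4 * ulog (Real.exp 1 * U / σ)) ^ (1 / α)

end McDiarmid

end

/-!
The proof follows the entropy method, with truncation at the level `M = zK`, where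
`z = zParam U σ α`.

*Tensorization.* For `F = f`, `t > 0` and `ψ(s) = s e^s - e^s + 1`, the entropy of `e^{tF}` is at
most the mean of `e^{tF}` times the essential supremum of `∑ₖ Eₖ ψ(t fₖ)`, where `Eₖ` integrates out
the coordinate `k` and `fₖ = F - Eₖ F` (`entropy_exp_le`). Writing `log (e^{tF} / E e^{tF})` as the
telescoping sum of the logarithms of the ratios `hₖ` of successive tail marginals, which satisfy
`Eₖ hₖ = 1`, this is Young's inequality `e^s log h ≤ ψ(s) - 1 + h` at `s = t fₖ`, combined with
Jensen's inequality `e^{t Eₖ F} ≤ Eₖ e^{tF}`. Unlike a martingale argument, this uses the almost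
sure bound on `∑ₖ σₖ²` itself, and not its conditional means.

*Herbst's argument.* The derivative of `t ↦ cgf t / t` is the entropy divided by `t ^ 2` and by the
mean of `e^{tF}`, so that bounds on `∑ₖ Eₖ ψ(t fₖ)` integrate to bounds on the cumulant generating
function (`cgf_le_of_sum_entPsi_le`). Exponential integrability of `F` comes from applying the same
argument to truncations of `F` (`lintegral_exp_mul_lt_top`).

*The entropies of the sections.* Let `b = tM ≤ α z^α / 2`. Where `fₖ ≤ M`, one has
`ψ(t fₖ) ≤ ψ(b) fₖ² / M²`; the excess beyond `M` is absorbed by the Orlicz function at a cost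
proportional to `Uₖ²` (`entPsi_mul_le_orliczPsi`). The value of `z` is such that the costs sum to at
most `(5/12) b ψ(b) σ² / M²` (`sq_mul_tail_le`). Hence
`cgf l - l E F ≤ (σ² / M²) (1 + 5a/12) (e^a - 1 - a)` for `a = lM ≤ α z^α / 2`
(`cgf_le_of_diffOrlicz_le`), and Chernoff's bound, with Bernstein's choice of `a` or with `a` a
quarter of the denominator in the first claim, gives both claims (`deviation_of_cgf_le`).

The factor `(n + 1) / n` is not needed: both bounds hold with `1` in its place, which is stronger.
-/

namespace McDiarmid

/-! ### Integrating out one coordinate of a product measure -/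

section Coordinate

variable {ι : Type*} [DecidableEq ι] {X : ι → Type*} [∀ i, MeasurableSpace (X i)]
  {μ : ∀ i, Measure (X i)}

/-- The mean of `F` with respect to the coordinate `k`, the other coordinates being fixed. -/
noncomputable def coordMean (μ : ∀ i, Measure (X i)) (k : ι) (F : (∀ i, X i) → ℝ)
    (y : ∀ i, X i) : ℝ :=
  ∫ x, F (Function.update y k x) ∂μ k

@[simp] lemma coordMean_update (k : ι) (F : (∀ i, X i) → ℝ) (y : ∀ i, X i) (x : X k) :
    coordMean μ k F (Function.update y k x) = coordMean μ k F y := by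
  simp [coordMean]

lemma measurable_update_prod (k : ι) :
    Measurable (fun p : (∀ i, X i) × X k => Function.update p.1 k p.2) := by
  rw [measurable_pi_iff]
  intro j
  by_cases hj : j = k
  · subst hj
    simpa using measurable_snd
  · simp only [Function.update_of_ne hj]
    exact (measurable_pi_apply j).comp measurable_fst

lemma measurable_comp_update {β : Type*} [MeasurableSpace β] {g : (∀ i, X i) → β}
    (hg : Measurable g) (k : ι) (y : ∀ i, X i) :
    Measurable fun x : X k => g (Function.update y k x) :=
  hg.comp (measurable_update y)

variable [∀ i, IsProbabilityMeasure (μ i)]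

lemma measurable_coordMean (k : ι) {F : (∀ i, X i) → ℝ} (hF : Measurable F) :
    Measurable (coordMean μ k F) :=
  ((hF.comp (measurable_update_prod k)).stronglyMeasurable.integral_prod_right'
    (ν := μ k)).measurable

variable [Fintype ι]

lemma lintegral_lintegral_update (k : ι) {g : (∀ i, X i) → ℝ≥0∞} (hg : Measurable g) :
    ∫⁻ y, ∫⁻ x, g (Function.update y k x) ∂μ k ∂Measure.pi μ = ∫⁻ y, g y ∂Measure.pi μ := by
  have h := lmarginal_singleton (μ := μ) g k
  rw [← h]
  refine lintegral_eq_of_lmarginal_eq {k} (hg.lmarginal μ) hg ?_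
  funext y
  rw [lmarginal_singleton]
  simp [lmarginal_update_of_mem]

/-- Resampling the coordinate `k` independently does not change the product measure. -/
lemma measurePreserving_update (k : ι) :
    MeasurePreserving (fun p : (∀ i, X i) × X k => Function.update p.1 k p.2)
      ((Measure.pi μ).prod (μ k)) (Measure.pi μ) := by
  refine ⟨measurable_update_prod k, ?_⟩
  refine Measure.ext_of_lintegral _ fun g hg => ?_
  rw [lintegral_map hg (measurable_update_prod k),
    lintegral_prod (fun p : (∀ i, X i) × X k => g (Function.update p.1 k p.2))
      (hg.comp (measurable_update_prod k)).aemeasurable]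
  exact lintegral_lintegral_update k hg

lemma ae_integrable_update (k : ι) {F : (∀ i, X i) → ℝ} (h : Integrable F (Measure.pi μ)) :
    ∀ᵐ y ∂Measure.pi μ, Integrable (fun x => F (Function.update y k x)) (μ k) :=
  (((measurePreserving_update k).integrable_comp h.aestronglyMeasurable).2 h).prod_right_ae

/-- Jensen's inequality for the exponential and the integration over one coordinate. -/
lemma ae_exp_coordMean_le (k : ι) {F : (∀ i, X i) → ℝ} (hF : Integrable F (Measure.pi μ))
    (t : ℝ) :
    ∀ᵐ y ∂Measure.pi μ, ENNReal.ofReal (Real.exp (t * coordMean μ k F y)) ≤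
      ∫⁻ x, ENNReal.ofReal (Real.exp (t * F (Function.update y k x))) ∂μ k := by
  filter_upwards [ae_integrable_update k hF] with y hy
  set A := coordMean μ k F y with hA
  have hd : Integrable (fun x => t * (F (Function.update y k x) - A)) (μ k) :=
    (hy.sub (integrable_const A)).const_mul t
  have hi : Integrable (fun x => Real.exp (t * A) * (1 + t * (F (Function.update y k x) - A)))
      (μ k) := ((integrable_const 1).add hd).const_mul _
  calc ENNReal.ofReal (Real.exp (t * A))
      = ENNReal.ofReal
          (∫ x, Real.exp (t * A) * (1 + t * (F (Function.update y k x) - A)) ∂μ k) := by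
        congr 1
        rw [integral_const_mul, integral_add (integrable_const 1) hd, integral_const_mul,
          integral_sub hy (integrable_const A)]
        have : ∫ x, F (Function.update y k x) ∂μ k = A := rfl
        simp [this]
    _ ≤ ∫⁻ x, ENNReal.ofReal
          (Real.exp (t * A) * (1 + t * (F (Function.update y k x) - A))) ∂μ k := by
        rw [integral_eq_lintegral_pos_part_sub_lintegral_neg_part hi]
        refine (ENNReal.ofReal_le_ofReal (sub_le_self _ ENNReal.toReal_nonneg)).trans ?_
        exact ENNReal.ofReal_toReal_le
    _ ≤ _ := by
        refine lintegral_mono fun x => ENNReal.ofReal_le_ofReal ?_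
        have h1 := Real.add_one_le_exp (t * (F (Function.update y k x) - A))
        calc _ ≤ Real.exp (t * A) * Real.exp (t * (F (Function.update y k x) - A)) := by
              gcongr; linarith
          _ = _ := by rw [← Real.exp_add]; ring_nf

end Coordinate

/-! ### Tensorization of the entropy -/

/-- The function `s ↦ s e^s - e^s + 1` which controls the entropy of `e^s`. -/
noncomputable def entPsi (s : ℝ) : ℝ := s * Real.exp s - Real.exp s + 1

lemma continuous_entPsi : Continuous entPsi := by unfold entPsi; fun_prop

lemma measurable_entPsi : Measurable entPsi := continuous_entPsi.measurable

lemma entPsi_nonneg (s : ℝ) : 0 ≤ entPsi s := by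
  have h := Real.add_one_le_exp (-s)
  have h2 : Real.exp s * Real.exp (-s) = 1 := by rw [← Real.exp_add]; simp
  have h3 := mul_le_mul_of_nonneg_left h (Real.exp_pos s).le
  unfold entPsi
  nlinarith

/-- The Young inequality dual to the entropy of `e^s`. -/
lemma exp_mul_log_le (s : ℝ) {h : ℝ} (hh : 0 < h) :
    Real.exp s * Real.log h ≤ entPsi s - 1 + h := by
  have h1 := Real.log_le_sub_one_of_pos (mul_pos hh (Real.exp_pos (-s)))
  rw [Real.log_mul hh.ne' (Real.exp_pos _).ne', Real.log_exp] at h1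
  have h2 : Real.exp s * Real.exp (-s) = 1 := by rw [← Real.exp_add]; simp
  have h3 := mul_le_mul_of_nonneg_left h1 (Real.exp_pos s).le
  unfold entPsi
  nlinarith

section Tensorization

variable {n : ℕ} {X : Fin n → Type*} [∀ i, MeasurableSpace (X i)]
  {μ : ∀ i, Measure (X i)}

/-- The function `g` with the coordinates of index at least `i` integrated out. -/
noncomputable def tailMarginal (μ : ∀ i, Measure (X i)) (i : ℕ) (g : (∀ i, X i) → ℝ≥0∞) :
    (∀ i, X i) → ℝ≥0∞ :=
  lmarginal μ (Finset.univ.filter fun j : Fin n => i ≤ j) g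

lemma tailMarginal_self (g : (∀ i, X i) → ℝ≥0∞) : tailMarginal μ n g = g := by
  have : (Finset.univ.filter fun j : Fin n => n ≤ j) = ∅ := by
    ext j; simp
  simp [tailMarginal, this]

lemma tailMarginal_update (k : Fin n) (g : (∀ i, X i) → ℝ≥0∞) (y : ∀ i, X i) (x : X k) :
    tailMarginal μ k g (Function.update y k x) = tailMarginal μ k g y :=
  lmarginal_update_of_mem μ (by simp) g y x

variable [∀ i, IsProbabilityMeasure (μ i)]

lemma measurable_tailMarginal (i : ℕ) {g : (∀ i, X i) → ℝ≥0∞} (hg : Measurable g) :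
    Measurable (tailMarginal μ i g) := hg.lmarginal μ

lemma tailMarginal_zero (g : (∀ i, X i) → ℝ≥0∞) (y : ∀ i, X i) :
    tailMarginal μ 0 g y = ∫⁻ y, g y ∂Measure.pi μ := by
  simp [tailMarginal]

lemma tailMarginal_eq_lintegral (k : Fin n) {g : (∀ i, X i) → ℝ≥0∞} (hg : Measurable g)
    (y : ∀ i, X i) :
    tailMarginal μ k g y = ∫⁻ x, tailMarginal μ (k + 1) g (Function.update y k x) ∂μ k := by
  have : (Finset.univ.filter fun j : Fin n => (k : ℕ) ≤ j) =
      insert k (Finset.univ.filter fun j : Fin n => (k : ℕ) + 1 ≤ j) := by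
    ext j
    simp only [Finset.mem_filter, Finset.mem_univ, true_and, Finset.mem_insert, Fin.ext_iff]
    omega
  rw [tailMarginal, this, lmarginal_insert g hg (by simp)]
  rfl

lemma lintegral_tailMarginal (i : ℕ) {g : (∀ i, X i) → ℝ≥0∞} (hg : Measurable g) :
    ∫⁻ y, tailMarginal μ i g y ∂Measure.pi μ = ∫⁻ y, g y ∂Measure.pi μ := by
  refine lintegral_eq_of_lmarginal_eq (Finset.univ.filter fun j : Fin n => i ≤ j)
    (measurable_tailMarginal i hg) hg ?_
  funext y
  have h : ∀ z : ∀ j : (Finset.univ.filter fun j : Fin n => i ≤ j), X j,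
      tailMarginal μ i g (Function.updateFinset y _ z) = tailMarginal μ i g y := by
    intro z
    refine lmarginal_congr μ g fun j hj => ?_
    simp [Function.updateFinset, hj]
  rw [lmarginal]
  simp only [h, lintegral_const, measure_univ, mul_one]
  rfl

lemma tailMarginal_pos (i : ℕ) {g : (∀ i, X i) → ℝ≥0∞} (hg : Measurable g) (h : ∀ y, 0 < g y)
    (y : ∀ i, X i) : 0 < tailMarginal μ i g y := by
  rw [tailMarginal, lmarginal, lintegral_pos_iff_support]
  · have : (Function.support fun z : ∀ j : (Finset.univ.filter fun j : Fin n => i ≤ j), X j =>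
        g (Function.updateFinset y _ z)) = Set.univ := by
      ext z; simp [(h _).ne']
    rw [this]
    simp
  · exact hg.comp measurable_updateFinset

/-- The ratio of two successive tail marginals of `g` has mean at most one in the coordinate that
separates them. -/
lemma lintegral_tailMarginal_div_le (k : Fin n) {g : (∀ i, X i) → ℝ≥0∞} (hg : Measurable g)
    (y : ∀ i, X i) :
    ∫⁻ x, tailMarginal μ (k + 1) g (Function.update y k x) /
      tailMarginal μ k g (Function.update y k x) ∂μ k ≤ 1 := by
  simp only [tailMarginal_update]
  have hm : Measurable fun x : X k => tailMarginal μ (k + 1) g (Function.update y k x) :=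
    (measurable_tailMarginal _ hg).comp (measurable_update y)
  simp only [div_eq_mul_inv]
  rw [lintegral_mul_const _ hm, ← tailMarginal_eq_lintegral k hg, ← div_eq_mul_inv]
  exact ENNReal.div_self_le_one

/-- Tensorization of the entropy, in the form needed for the exponential of a function `F`:
the entropy of `e^{tF}`, divided by the mean of `e^{tF}`, is at most the essential supremum of the
sum of the means of `entPsi` of the centred coordinate sections of `tF`. -/
theorem entropy_exp_le {F : (∀ i, X i) → ℝ} (hF : Measurable F)
    (hFi : Integrable F (Measure.pi μ)) {t : ℝ}
    (he : Integrable (fun y => Real.exp (t * F y)) (Measure.pi μ))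
    (hFe : Integrable (fun y => F y * Real.exp (t * F y)) (Measure.pi μ)) {G : ℝ} (hG0 : 0 ≤ G)
    (hG : ∀ᵐ y ∂Measure.pi μ, ∑ k, ∫⁻ x, ENNReal.ofReal
      (entPsi (t * (F (Function.update y k x) - coordMean μ k F y))) ∂μ k ≤ ENNReal.ofReal G) :
    t * ∫ y, F y * Real.exp (t * F y) ∂Measure.pi μ -
      (∫ y, Real.exp (t * F y) ∂Measure.pi μ) * Real.log (∫ y, Real.exp (t * F y) ∂Measure.pi μ)
      ≤ G * ∫ y, Real.exp (t * F y) ∂Measure.pi μ := by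
  set Z := ∫ y, Real.exp (t * F y) ∂Measure.pi μ with hZ
  have hZ0 : 0 ≤ Z := integral_nonneg fun _ => (Real.exp_pos _).le
  set g : (∀ i, X i) → ℝ≥0∞ := fun y => ENNReal.ofReal (Real.exp (t * F y)) with hg_def
  have hg : Measurable g := by fun_prop
  have hgpos : ∀ y, 0 < g y := fun y => ENNReal.ofReal_pos.2 (Real.exp_pos _)
  have hgZ : ∫⁻ y, g y ∂Measure.pi μ = ENNReal.ofReal Z :=
    (ofReal_integral_eq_lintegral_ofReal he (.of_forall fun _ => (Real.exp_pos _).le)).symm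
  set A : Fin n → (∀ i, X i) → ℝ := fun k => coordMean μ k F with hA
  have hAm : ∀ k, Measurable (A k) := fun k => measurable_coordMean k hF
  set h : Fin n → (∀ i, X i) → ℝ≥0∞ := fun k y => tailMarginal μ (k + 1) g y / tailMarginal μ k g y
    with hh_def
  have hhm : ∀ k, Measurable (h k) := fun k =>
    (measurable_tailMarginal _ hg).div (measurable_tailMarginal _ hg)
  set eA : Fin n → (∀ i, X i) → ℝ≥0∞ := fun k y => ENNReal.ofReal (Real.exp (t * A k y)) with heA
  have heAm : ∀ k, Measurable (eA k) := fun k => by fun_prop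
  have heA_update : ∀ k y x, eA k (Function.update y k x) = eA k y := by
    intro k y x; simp [heA, hA]
  have heA_le : ∀ k, ∫⁻ y, eA k y ∂Measure.pi μ ≤ ENNReal.ofReal Z := by
    intro k
    rw [← hgZ, ← lintegral_lintegral_update k hg]
    exact lintegral_mono_ae (ae_exp_coordMean_le k hFi t)
  have heA_int : ∀ k, Integrable (fun y => Real.exp (t * A k y)) (Measure.pi μ) := by
    intro k
    refine ⟨by fun_prop, ?_⟩
    rw [hasFiniteIntegral_iff_ofReal (.of_forall fun _ => (Real.exp_pos _).le)]
    exact (heA_le k).trans_lt ENNReal.ofReal_lt_top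
  set ps : Fin n → (∀ i, X i) → ℝ≥0∞ := fun k y => ENNReal.ofReal (entPsi (t * (F y - A k y)))
    with hps
  have hpsm : ∀ k, Measurable (ps k) := fun k => by
    have := measurable_entPsi
    fun_prop
  have heAh : ∀ k, Measurable fun y => eA k y * h k y := fun k => (heAm k).mul (hhm k)
  have heAps : ∀ k, Measurable fun y => eA k y * ps k y := fun k => (heAm k).mul (hpsm k)
  -- the two bounds obtained by integrating first over the coordinate `k`
  have hI1 : ∀ k, ∫⁻ y, eA k y * h k y ∂Measure.pi μ ≤ ∫⁻ y, eA k y ∂Measure.pi μ := by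
    intro k
    rw [← lintegral_lintegral_update k (heAh k)]
    refine lintegral_mono fun y => ?_
    simp only [heA_update]
    rw [lintegral_const_mul _ (measurable_comp_update (hhm k) k y)]
    calc _ ≤ eA k y * 1 := by gcongr; exact lintegral_tailMarginal_div_le k hg y
      _ = _ := mul_one _
  have hI2 : ∑ k, ∫⁻ y, eA k y * ps k y ∂Measure.pi μ ≤ ENNReal.ofReal (G * Z) := by
    have hpk : ∀ k, Measurable fun y => ∫⁻ x, ps k (Function.update y k x) ∂μ k := fun k =>
      ((hpsm k).comp (measurable_update_prod k)).lintegral_prod_right'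
    have hgp : ∀ k, Measurable fun y => g y * ∫⁻ x, ps k (Function.update y k x) ∂μ k :=
      fun k => hg.mul (hpk k)
    have h1 : ∀ k, ∫⁻ y, eA k y * ps k y ∂Measure.pi μ ≤
        ∫⁻ y, g y * ∫⁻ x, ps k (Function.update y k x) ∂μ k ∂Measure.pi μ := by
      intro k
      rw [← lintegral_lintegral_update k (heAps k),
        ← lintegral_lintegral_update k (hgp k)]
      refine lintegral_mono_ae ?_
      filter_upwards [ae_exp_coordMean_le k hFi t] with y hy
      simp only [heA_update, Function.update_idem]
      rw [lintegral_const_mul _ (measurable_comp_update (hpsm k) k y),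
        lintegral_mul_const _ (measurable_comp_update hg k y)]
      gcongr
    refine (Finset.sum_le_sum fun k _ => h1 k).trans ?_
    rw [← lintegral_finsetSum _ fun k _ => hgp k]
    calc _ ≤ ∫⁻ y, g y * ENNReal.ofReal G ∂Measure.pi μ := by
          refine lintegral_mono_ae ?_
          filter_upwards [hG] with y hy
          rw [← Finset.mul_sum]
          gcongr
          refine le_trans (le_of_eq ?_) hy
          simp [hps, hA]
      _ = _ := by rw [lintegral_mul_const _ hg, hgZ, ← ENNReal.ofReal_mul hZ0, mul_comm]
  -- the pointwise inequality
  have hlt : ∀ᵐ y ∂Measure.pi μ, ∀ i : ℕ, tailMarginal μ i g y < ∞ := by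
    rw [ae_all_iff]
    intro i
    refine ae_lt_top (measurable_tailMarginal i hg) ?_
    rw [lintegral_tailMarginal i hg, hgZ]
    exact ENNReal.ofReal_ne_top
  set ℓ : (∀ i, X i) → ℝ := fun y => t * (F y * Real.exp (t * F y)) -
    Real.log Z * Real.exp (t * F y) + ∑ k, Real.exp (t * A k y) with hℓ
  have hℓi : Integrable ℓ (Measure.pi μ) := by
    refine ((hFe.const_mul t).sub (he.const_mul _)).add ?_
    exact integrable_finsetSum _ fun k _ => heA_int k
  have hpt : ∀ᵐ y ∂Measure.pi μ, ENNReal.ofReal (ℓ y) ≤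
      ∑ k, eA k y * ps k y + ∑ k, eA k y * h k y := by
    filter_upwards [hlt] with y hy
    have hpos : ∀ i, 0 < (tailMarginal μ i g y).toReal := fun i =>
      ENNReal.toReal_pos (tailMarginal_pos i hg hgpos y).ne' (hy i).ne
    have hhk : ∀ k, h k y = ENNReal.ofReal ((h k y).toReal) := fun k => by
      rw [ENNReal.ofReal_toReal]
      exact (ENNReal.div_lt_top (hy _).ne (tailMarginal_pos k hg hgpos y).ne').ne
    have hhpos : ∀ k, 0 < (h k y).toReal := fun k => by
      simp only [hh_def, ENNReal.toReal_div]
      exact div_pos (hpos _) (hpos _)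
    have htel : ∑ k, Real.log (h k y).toReal = t * F y - Real.log Z := by
      have : ∀ k : Fin n, Real.log (h k y).toReal =
          (fun i : ℕ => Real.log (tailMarginal μ (i + 1) g y).toReal -
            Real.log (tailMarginal μ i g y).toReal) k := by
        intro k
        simp only [hh_def, ENNReal.toReal_div]
        rw [Real.log_div (hpos _).ne' (hpos _).ne']
      rw [Finset.sum_congr rfl fun k _ => this k, Fin.sum_univ_eq_sum_range
        (fun i : ℕ => Real.log (tailMarginal μ (i + 1) g y).toReal -
            Real.log (tailMarginal μ i g y).toReal) n,
        Finset.sum_range_sub (fun i => Real.log (tailMarginal μ i g y).toReal),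
        tailMarginal_self, tailMarginal_zero, hgZ, ENNReal.toReal_ofReal hZ0,
        ENNReal.toReal_ofReal (Real.exp_pos _).le, Real.log_exp]
    have hreal : ℓ y ≤ ∑ k, Real.exp (t * A k y) * entPsi (t * (F y - A k y)) +
        ∑ k, Real.exp (t * A k y) * (h k y).toReal := by
      have : ℓ y = ∑ k, (Real.exp (t * F y) * Real.log (h k y).toReal + Real.exp (t * A k y)) := by
        rw [Finset.sum_add_distrib, ← Finset.mul_sum, htel, hℓ]
        ring
      rw [this, ← Finset.sum_add_distrib]
      refine Finset.sum_le_sum fun k _ => ?_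
      have h1 := mul_le_mul_of_nonneg_left (exp_mul_log_le (t * (F y - A k y)) (hhpos k))
        (Real.exp_pos (t * A k y)).le
      rw [← mul_assoc, ← Real.exp_add, show t * A k y + t * (F y - A k y) = t * F y by ring] at h1
      linarith
    refine (ENNReal.ofReal_le_ofReal hreal).trans (le_of_eq ?_)
    have e1 : ∀ k, 0 ≤ Real.exp (t * A k y) * entPsi (t * (F y - A k y)) := fun k =>
      mul_nonneg (Real.exp_pos _).le (entPsi_nonneg _)
    have e2 : ∀ k, 0 ≤ Real.exp (t * A k y) * (h k y).toReal := fun k =>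
      mul_nonneg (Real.exp_pos _).le (hhpos k).le
    rw [ENNReal.ofReal_add (Finset.sum_nonneg fun k _ => e1 k) (Finset.sum_nonneg fun k _ => e2 k),
      ENNReal.ofReal_sum_of_nonneg fun k _ => e1 k, ENNReal.ofReal_sum_of_nonneg fun k _ => e2 k]
    congr 1
    · refine Finset.sum_congr rfl fun k _ => ?_
      rw [ENNReal.ofReal_mul (Real.exp_pos _).le]
    · refine Finset.sum_congr rfl fun k _ => ?_
      rw [ENNReal.ofReal_mul (Real.exp_pos _).le, ← hhk k]
  have hfin : ∫⁻ y, ENNReal.ofReal (ℓ y) ∂Measure.pi μ ≤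
      ENNReal.ofReal (G * Z + ∑ k, ∫ y, Real.exp (t * A k y) ∂Measure.pi μ) := by
    have hs : ∀ k, 0 ≤ ∫ y, Real.exp (t * A k y) ∂Measure.pi μ := fun k =>
      integral_nonneg fun _ => (Real.exp_pos _).le
    rw [ENNReal.ofReal_add (mul_nonneg hG0 hZ0) (Finset.sum_nonneg fun k _ => hs k),
      ENNReal.ofReal_sum_of_nonneg fun k _ => hs k]
    refine (lintegral_mono_ae hpt).trans ?_
    rw [lintegral_add_left (Finset.measurable_sum _ fun k _ => heAps k),
      lintegral_finsetSum _ fun k _ => heAps k,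
      lintegral_finsetSum _ fun k _ => heAh k]
    refine add_le_add hI2 (Finset.sum_le_sum fun k _ => ?_)
    rw [ofReal_integral_eq_lintegral_ofReal (heA_int k) (.of_forall fun _ => (Real.exp_pos _).le)]
    exact hI1 k
  have hmain : ∫ y, ℓ y ∂Measure.pi μ ≤
      G * Z + ∑ k, ∫ y, Real.exp (t * A k y) ∂Measure.pi μ := by
    rw [integral_eq_lintegral_pos_part_sub_lintegral_neg_part hℓi]
    refine (sub_le_self _ ENNReal.toReal_nonneg).trans ?_
    refine ENNReal.toReal_le_of_le_ofReal ?_ hfin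
    exact add_nonneg (mul_nonneg hG0 hZ0) (Finset.sum_nonneg fun k _ =>
      integral_nonneg fun _ => (Real.exp_pos _).le)
  have hcalc : ∫ y, ℓ y ∂Measure.pi μ = t * ∫ y, F y * Real.exp (t * F y) ∂Measure.pi μ -
      Real.log Z * Z + ∑ k, ∫ y, Real.exp (t * A k y) ∂Measure.pi μ := by
    have hd : Integrable (fun y => t * (F y * Real.exp (t * F y)) -
        Real.log Z * Real.exp (t * F y)) (Measure.pi μ) :=
      (hFe.const_mul t).sub (he.const_mul _)
    simp only [hℓ]
    rw [integral_add hd (integrable_finsetSum _ fun k _ => heA_int k),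
      integral_sub (hFe.const_mul t) (he.const_mul _), integral_const_mul, integral_const_mul,
      integral_finsetSum _ fun k _ => heA_int k]
  rw [hcalc] at hmain
  linarith

end Tensorization

/-! ### From entropy bounds to cumulant bounds -/

section Herbst

open Filter Topology

variable {n : ℕ} {X : Fin n → Type*} [∀ i, MeasurableSpace (X i)]
  {μ : ∀ i, Measure (X i)} [∀ i, IsProbabilityMeasure (μ i)]

/-- Herbst's argument: the tensorized entropy bound says that the derivative of `t ↦ cgf t / t` is
at most `Γ'`, and this function tends to the mean of `F` at `0`. -/
theorem cgf_le_of_sum_entPsi_le {F : (∀ i, X i) → ℝ} (hF : Measurable F) {l : ℝ} (hl : 0 < l)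
    (hint : ∀ t ∈ Set.Icc 0 l, t ∈ interior (integrableExpSet F (Measure.pi μ)))
    {Γ Γ' : ℝ → ℝ} (hΓ : ∀ t ∈ Set.Ioc 0 l, HasDerivAt Γ (Γ' t) t)
    (hΓ' : ∀ t ∈ Set.Ioc 0 l, 0 ≤ Γ' t) (hΓ0 : Tendsto Γ (𝓝[>] 0) (𝓝 0))
    (hG : ∀ t ∈ Set.Ioc 0 l, ∀ᵐ y ∂Measure.pi μ, ∑ k, ∫⁻ x, ENNReal.ofReal
      (entPsi (t * (F (Function.update y k x) - coordMean μ k F y))) ∂μ k ≤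
        ENNReal.ofReal (t ^ 2 * Γ' t)) :
    cgf F (Measure.pi μ) l ≤ l * (∫ y, F y ∂Measure.pi μ + Γ l) := by
  have h0 : (0 : ℝ) ∈ interior (integrableExpSet F (Measure.pi μ)) :=
    hint 0 ⟨le_rfl, hl.le⟩
  have hFi : Integrable F (Measure.pi μ) := integrable_of_mem_interior_integrableExpSet h0
  set L := cgf F (Measure.pi μ) with hL
  have hder : ∀ t ∈ Set.Ioc 0 l, HasDerivAt (fun s => L s / s - Γ s)
      ((deriv L t * t - L t * 1) / t ^ 2 - Γ' t) t := by
    intro t ht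
    have h1 : HasDerivAt L (deriv L t) t :=
      (analyticAt_cgf (hint t ⟨ht.1.le, ht.2⟩)).differentiableAt.hasDerivAt
    exact (h1.div (hasDerivAt_id t) ht.1.ne').sub (hΓ t ht)
  have hanti : AntitoneOn (fun s => L s / s - Γ s) (Set.Ioc 0 l) := by
    refine antitoneOn_of_deriv_nonpos (convex_Ioc 0 l)
      (fun t ht => (hder t ht).continuousAt.continuousWithinAt)
      (fun t ht => (hder t (interior_subset ht)).differentiableAt.differentiableWithinAt) ?_
    intro t ht
    have ht' := interior_subset ht
    rw [(hder t ht').deriv]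
    have hti := hint t ⟨ht'.1.le, ht'.2⟩
    have he : Integrable (fun y => Real.exp (t * F y)) (Measure.pi μ) :=
      integrable_of_mem_integrableExpSet (interior_subset hti)
    have hFe : Integrable (fun y => F y * Real.exp (t * F y)) (Measure.pi μ) := by
      simpa using integrable_pow_mul_exp_of_mem_interior_integrableExpSet hti 1
    have hent := entropy_exp_le hF hFi he hFe
      (mul_nonneg (sq_nonneg t) (hΓ' t ht')) (hG t ht')
    have hZ : 0 < ∫ y, Real.exp (t * F y) ∂Measure.pi μ := mgf_pos he
    have hd : deriv L t = (∫ y, F y * Real.exp (t * F y) ∂Measure.pi μ) /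
        ∫ y, Real.exp (t * F y) ∂Measure.pi μ := deriv_cgf hti
    have hLt : L t = Real.log (∫ y, Real.exp (t * F y) ∂Measure.pi μ) := rfl
    have ht2 : 0 < t ^ 2 := pow_pos ht'.1 2
    rw [sub_nonpos, div_le_iff₀ ht2, hd, hLt, mul_one]
    rw [sub_le_iff_le_add, div_mul_eq_mul_div, div_le_iff₀ hZ]
    linarith
  have hlim : Tendsto (fun s => L s / s - Γ s) (𝓝[>] 0) (𝓝 (∫ y, F y ∂Measure.pi μ - 0)) := by
    refine Tendsto.sub ?_ hΓ0
    have h1 : HasDerivAt L (∫ y, F y ∂Measure.pi μ) 0 := by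
      have h := (analyticAt_cgf h0).differentiableAt.hasDerivAt
      rw [deriv_cgf_zero h0] at h
      simpa using h
    have h2 := h1.tendsto_slope_zero
    have h3 : Tendsto (fun s => s⁻¹ • (L (0 + s) - L 0)) (𝓝[>] 0)
        (𝓝 (∫ y, F y ∂Measure.pi μ)) :=
      h2.mono_left (nhdsWithin_mono 0 fun s hs => (ne_of_gt hs : s ≠ 0))
    refine h3.congr fun s => ?_
    have : L 0 = 0 := cgf_zero
    simp [this, div_eq_inv_mul]
  have hle : L l / l - Γ l ≤ ∫ y, F y ∂Measure.pi μ - 0 := by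
    refine ge_of_tendsto hlim ?_
    filter_upwards [Ioc_mem_nhdsGT hl] with s hs
    exact hanti hs ⟨hl, le_rfl⟩ hs.2
  rw [sub_zero, sub_le_iff_le_add, div_le_iff₀ hl] at hle
  linarith

end Herbst

/-! ### Exponential integrability -/

section ExpIntegrable

lemma entPsi_le_sq_mul_exp (s : ℝ) : entPsi s ≤ s ^ 2 * Real.exp |s| := by
  have h1 : entPsi s ≤ s * (Real.exp s - 1) := by
    have := Real.add_one_le_exp s
    unfold entPsi
    linarith
  refine h1.trans ?_
  rcases le_total 0 s with hs | hs
  · rw [abs_of_nonneg hs, sq, mul_assoc]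
    refine mul_le_mul_of_nonneg_left ?_ hs
    have h2 : Real.exp s * Real.exp (-s) = 1 := by rw [← Real.exp_add]; simp
    have h3 := mul_le_mul_of_nonneg_left (Real.add_one_le_exp (-s)) (Real.exp_pos s).le
    linarith
  · have h2 := Real.add_one_le_exp s
    have h3 : 1 ≤ Real.exp |s| := Real.one_le_exp (abs_nonneg s)
    nlinarith [sq_nonneg s]

/-- The truncation of a real number to `[-m, m]`. -/
noncomputable def clip (m a : ℝ) : ℝ := max (-m) (min a m)

lemma abs_clip_sub_le (m a b : ℝ) : |clip m a - clip m b| ≤ |a - b| := by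
  unfold clip
  calc |max (-m) (min a m) - max (-m) (min b m)| ≤ |min a m - min b m| := by
        simpa using abs_max_sub_max_le_max (-m) (min a m) (-m) (min b m)
    _ ≤ |a - b| := by simpa using abs_min_sub_min_le_max a m b m

lemma abs_clip_le {m : ℝ} (hm : 0 ≤ m) (a : ℝ) : |clip m a| ≤ m := by
  unfold clip
  rw [abs_le]
  exact ⟨le_max_left _ _, max_le (by linarith) (min_le_right _ _)⟩

lemma abs_clip_le_abs {m : ℝ} (hm : 0 ≤ m) (a : ℝ) : |clip m a| ≤ |a| := by
  have h : clip m 0 = 0 := by simp [clip, hm]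
  simpa [h] using abs_clip_sub_le m a 0

lemma clip_eq_self {m a : ℝ} (h : |a| ≤ m) : clip m a = a := by
  obtain ⟨h1, h2⟩ := abs_le.1 h
  simp [clip, h1, h2]

lemma measurable_clip (m : ℝ) : Measurable (clip m) := by
  unfold clip
  fun_prop

/-- A centred truncation is controlled by the centred variable and its first absolute moment. -/
lemma abs_clip_sub_integral_le {S : Type*} [MeasurableSpace S] {ν : Measure S}
    [IsProbabilityMeasure ν] {φ : S → ℝ} (hφ : Integrable φ ν) (c : ℝ) {m : ℝ} (hm : 0 ≤ m)
    (u : S) :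
    |clip m (φ u) - ∫ x, clip m (φ x) ∂ν| ≤ |φ u - c| + ∫ x, |φ x - c| ∂ν := by
  have hcl : Integrable (fun x => clip m (φ x)) ν := by
    refine hφ.mono ((measurable_clip m).comp_aemeasurable hφ.aemeasurable).aestronglyMeasurable ?_
    exact .of_forall fun x => abs_clip_le_abs hm _
  have h1 : clip m (φ u) - ∫ x, clip m (φ x) ∂ν = ∫ x, (clip m (φ u) - clip m (φ x)) ∂ν := by
    rw [integral_sub (integrable_const _) hcl]
    simp
  have habs : Integrable (fun x => |φ x - c|) ν := (hφ.sub (integrable_const c)).abs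
  have h2 : |φ u - c| + ∫ x, |φ x - c| ∂ν = ∫ x, (|φ u - c| + |φ x - c|) ∂ν := by
    rw [integral_add (integrable_const _) habs]
    simp
  rw [h1, h2]
  refine (abs_integral_le_integral_abs).trans ?_
  refine integral_mono ((integrable_const _).sub hcl).abs ((integrable_const _).add habs) ?_
  intro x
  refine (abs_clip_sub_le m _ _).trans ?_
  rw [show φ u - φ x = (φ u - c) - (φ x - c) by ring]
  exact abs_sub _ _

variable {n : ℕ} {X : Fin n → Type*} [∀ i, MeasurableSpace (X i)]
  {μ : ∀ i, Measure (X i)} [∀ i, IsProbabilityMeasure (μ i)]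

/-- If the centred coordinate sections of `F` have uniformly bounded exponential moments, then
`F` has exponential moments. The entropy bound is applied to the truncations of `F`, for which it
holds uniformly, and the truncation is removed by Fatou's lemma. -/
theorem lintegral_exp_mul_lt_top {F : (∀ i, X i) → ℝ} (hF : Measurable F)
    (hFi : Integrable F (Measure.pi μ)) {θ C : ℝ} (hθ : 0 < θ)
    (hC : ∀ k, ∀ᵐ y ∂Measure.pi μ, ∫⁻ x, ENNReal.ofReal
      (Real.exp (θ * |F (Function.update y k x) - coordMean μ k F y|)) ∂μ k ≤ ENNReal.ofReal C)
    {l : ℝ} (hl : 0 < l) (hlθ : l < θ) :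
    ∫⁻ y, ENNReal.ofReal (Real.exp (l * F y)) ∂Measure.pi μ < ∞ := by
  set D : ℝ := n * (2 / (θ - l) ^ 2 * Real.exp C * max C 0) with hD
  have hD0 : 0 ≤ D := by positivity
  have hkey : ∀ m : ℝ, 0 ≤ m → ∀ t ∈ Set.Ioc 0 l, ∀ᵐ y ∂Measure.pi μ,
      ∑ k, ∫⁻ x, ENNReal.ofReal (entPsi (t * (clip m (F (Function.update y k x)) -
        coordMean μ k (fun y => clip m (F y)) y))) ∂μ k ≤ ENNReal.ofReal (t ^ 2 * D) := by
    intro m hm t ht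
    have hint : ∀ᵐ y ∂Measure.pi μ, ∀ k, Integrable (fun x => F (Function.update y k x)) (μ k) :=
      ae_all_iff.2 fun k => ae_integrable_update k hFi
    filter_upwards [ae_all_iff.2 hC, hint] with y hy hi
    have hk : ∀ k, ∫⁻ x, ENNReal.ofReal (entPsi (t * (clip m (F (Function.update y k x)) -
        coordMean μ k (fun y => clip m (F y)) y))) ∂μ k ≤
        ENNReal.ofReal (t ^ 2 * (2 / (θ - l) ^ 2 * Real.exp C * max C 0)) := by
      intro k
      set c := coordMean μ k F y with hc
      have habs : Integrable (fun x => |F (Function.update y k x) - c|) (μ k) :=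
        ((hi k).sub (integrable_const c)).abs
      have hC0 : 0 ≤ C ∧ θ * ∫ x, |F (Function.update y k x) - c| ∂μ k ≤ C := by
        have h1 : ENNReal.ofReal (∫ x, (θ * |F (Function.update y k x) - c| + 1) ∂μ k) ≤
            ENNReal.ofReal C := by
          have hi1 : Integrable (fun x => θ * |F (Function.update y k x) - c| + 1) (μ k) :=
            (habs.const_mul θ).add (integrable_const 1)
          rw [ofReal_integral_eq_lintegral_ofReal hi1
            (.of_forall fun x => add_nonneg (mul_nonneg hθ.le (abs_nonneg _)) zero_le_one)]
          refine (lintegral_mono fun x => ENNReal.ofReal_le_ofReal ?_).trans (hy k)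
          exact Real.add_one_le_exp _
        have h2 : ∫ x, (θ * |F (Function.update y k x) - c| + 1) ∂μ k =
            θ * ∫ x, |F (Function.update y k x) - c| ∂μ k + 1 := by
          rw [integral_add (habs.const_mul θ) (integrable_const 1), integral_const_mul]
          simp
        have h3 : 0 ≤ ∫ x, |F (Function.update y k x) - c| ∂μ k :=
          integral_nonneg fun x => abs_nonneg _
        have h5 : 0 ≤ θ * ∫ x, |F (Function.update y k x) - c| ∂μ k := by positivity
        rw [h2] at h1
        by_cases hCn : 0 ≤ C
        · have h4 := (ENNReal.ofReal_le_ofReal_iff hCn).1 h1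
          exact ⟨hCn, by linarith⟩
        · rw [ENNReal.ofReal_of_nonpos (not_le.1 hCn).le] at h1
          have := ENNReal.ofReal_eq_zero.1 (le_antisymm h1 bot_le)
          linarith
      obtain ⟨hCn, hCm⟩ := hC0
      have hpt : ∀ x, entPsi (t * (clip m (F (Function.update y k x)) -
          coordMean μ k (fun y => clip m (F y)) y)) ≤
          t ^ 2 * (2 / (θ - l) ^ 2 * Real.exp C) *
            Real.exp (θ * |F (Function.update y k x) - c|) := by
        intro x
        set v := clip m (F (Function.update y k x)) - coordMean μ k (fun y => clip m (F y)) y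
          with hv
        have hvle : |v| ≤ |F (Function.update y k x) - c| +
            ∫ x, |F (Function.update y k x) - c| ∂μ k :=
          abs_clip_sub_integral_le (hi k) c hm x
        have hθl : 0 < θ - l := by linarith
        have h1 : v ^ 2 ≤ 2 / (θ - l) ^ 2 * Real.exp ((θ - l) * |v|) := by
          have h := Real.quadratic_le_exp_of_nonneg (x := (θ - l) * |v|) (by positivity)
          rw [div_mul_eq_mul_div, le_div_iff₀ (by positivity)]
          have h2 : ((θ - l) * |v|) ^ 2 = v ^ 2 * (θ - l) ^ 2 := by
            rw [mul_pow, sq_abs]; ring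
          have h3 : 0 ≤ (θ - l) * |v| := by positivity
          nlinarith
        have h2 : Real.exp |t * v| ≤ Real.exp (l * |v|) := by
          rw [abs_mul, abs_of_pos ht.1]
          gcongr
          exact ht.2
        calc entPsi (t * v) ≤ (t * v) ^ 2 * Real.exp |t * v| := entPsi_le_sq_mul_exp _
          _ ≤ t ^ 2 * (2 / (θ - l) ^ 2 * Real.exp ((θ - l) * |v|)) * Real.exp (l * |v|) := by
              rw [mul_pow]; gcongr
          _ = t ^ 2 * (2 / (θ - l) ^ 2) * Real.exp (θ * |v|) := by
              rw [show θ * |v| = (θ - l) * |v| + l * |v| by ring, Real.exp_add]; ring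
          _ ≤ t ^ 2 * (2 / (θ - l) ^ 2) *
              (Real.exp C * Real.exp (θ * |F (Function.update y k x) - c|)) := by
              rw [← Real.exp_add]
              gcongr
              nlinarith
          _ = _ := by ring
      refine (lintegral_mono fun x => ENNReal.ofReal_le_ofReal (hpt x)).trans ?_
      simp_rw [ENNReal.ofReal_mul (show 0 ≤ t ^ 2 * (2 / (θ - l) ^ 2 * Real.exp C) by positivity)]
      rw [lintegral_const_mul' _ _ ENNReal.ofReal_ne_top]
      calc _ ≤ ENNReal.ofReal (t ^ 2 * (2 / (θ - l) ^ 2 * Real.exp C)) * ENNReal.ofReal C := by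
            gcongr
            exact hy k
        _ = _ := by
            rw [← ENNReal.ofReal_mul (by positivity), max_eq_left hCn]
            congr 1; ring
    refine (Finset.sum_le_sum fun k _ => hk k).trans (le_of_eq ?_)
    rw [Finset.sum_const, Finset.card_univ, Fintype.card_fin, hD, ← ENNReal.ofReal_nsmul]
    congr 1
    rw [nsmul_eq_mul]; ring
  have hbound : ∀ m : ℕ, ∫⁻ y, ENNReal.ofReal (Real.exp (l * clip m (F y))) ∂Measure.pi μ ≤
      ENNReal.ofReal (Real.exp (l * (∫ y, |F y| ∂Measure.pi μ + D * l))) := by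
    intro m
    have hm : (0 : ℝ) ≤ m := m.cast_nonneg
    have hFm : Measurable fun y => clip m (F y) := (measurable_clip m).comp hF
    have hexp : ∀ t : ℝ, Integrable (fun y => Real.exp (t * clip m (F y))) (Measure.pi μ) := by
      intro t
      refine Integrable.of_bound (hFm.const_mul t).exp.aestronglyMeasurable
        (Real.exp (|t| * m)) (.of_forall fun y => ?_)
      rw [Real.norm_of_nonneg (Real.exp_pos _).le]
      refine Real.exp_le_exp.2 ((le_abs_self _).trans ?_)
      rw [abs_mul]
      gcongr
      exact abs_clip_le hm _
    have huniv : integrableExpSet (fun y => clip m (F y)) (Measure.pi μ) = Set.univ :=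
      Set.eq_univ_of_forall hexp
    have hcgf := cgf_le_of_sum_entPsi_le (μ := μ) hFm hl (by simp [huniv])
      (Γ := fun t => D * t) (Γ' := fun _ => D)
      (fun t _ => by simpa using (hasDerivAt_id t).const_mul D) (fun _ _ => hD0)
      (by
        have : Filter.Tendsto (fun t : ℝ => D * t) (nhds 0) (nhds (D * 0)) :=
          (continuous_const_mul D).tendsto 0
        rw [mul_zero] at this
        exact this.mono_left nhdsWithin_le_nhds)
      (hkey m hm)
    rw [← ofReal_integral_eq_lintegral_ofReal (hexp l) (.of_forall fun _ => (Real.exp_pos _).le)]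
    refine ENNReal.ofReal_le_ofReal ?_
    have hmgf : ∫ y, Real.exp (l * clip m (F y)) ∂Measure.pi μ =
        Real.exp (cgf (fun y => clip m (F y)) (Measure.pi μ) l) := (exp_cgf (hexp l)).symm
    rw [hmgf]
    refine Real.exp_le_exp.2 (hcgf.trans ?_)
    gcongr
    · exact hFi.mono hFm.aestronglyMeasurable (.of_forall fun y => abs_clip_le_abs hm _)
    · exact hFi.abs
    · exact fun y => (le_abs_self _).trans (abs_clip_le_abs hm _)
  have hlim : ∀ y, Filter.Tendsto (fun m : ℕ => ENNReal.ofReal (Real.exp (l * clip m (F y))))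
      Filter.atTop (nhds (ENNReal.ofReal (Real.exp (l * F y)))) := by
    intro y
    refine tendsto_const_nhds.congr' ?_
    filter_upwards [Filter.eventually_ge_atTop ⌈|F y|⌉₊] with m hm
    rw [clip_eq_self ((Nat.le_ceil _).trans (by exact_mod_cast hm))]
  calc ∫⁻ y, ENNReal.ofReal (Real.exp (l * F y)) ∂Measure.pi μ
      = ∫⁻ y, Filter.liminf (fun m : ℕ => ENNReal.ofReal (Real.exp (l * clip m (F y))))
          Filter.atTop ∂Measure.pi μ := lintegral_congr fun y => ((hlim y).liminf_eq).symm
    _ ≤ Filter.liminf (fun m : ℕ => ∫⁻ y, ENNReal.ofReal (Real.exp (l * clip m (F y)))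
          ∂Measure.pi μ) Filter.atTop := lintegral_liminf_le fun m => by
          have := measurable_clip m
          fun_prop
    _ ≤ ENNReal.ofReal (Real.exp (l * (∫ y, |F y| ∂Measure.pi μ + D * l))) :=
        Filter.liminf_le_of_le ⟨0, by simp⟩ fun b hb => by
          obtain ⟨m, hm⟩ := hb.exists
          exact hm.trans (hbound m)
    _ < ∞ := ENNReal.ofReal_lt_top

theorem mem_interior_integrableExpSet_of_section {F : (∀ i, X i) → ℝ} (hF : Measurable F)
    (hFi : Integrable F (Measure.pi μ)) {θ C : ℝ} (hθ : 0 < θ)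
    (hC : ∀ k, ∀ᵐ y ∂Measure.pi μ, ∫⁻ x, ENNReal.ofReal
      (Real.exp (θ * |F (Function.update y k x) - coordMean μ k F y|)) ∂μ k ≤ ENNReal.ofReal C)
    {l : ℝ} (hl : |l| < θ) : l ∈ interior (integrableExpSet F (Measure.pi μ)) := by
  have hsub : Set.Ioo (-θ) θ ⊆ integrableExpSet F (Measure.pi μ) := by
    intro t ht
    refine ⟨by fun_prop, ?_⟩
    rw [hasFiniteIntegral_iff_ofReal (.of_forall fun _ => (Real.exp_pos _).le)]
    rcases lt_trichotomy t 0 with h | h | h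
    · have := lintegral_exp_mul_lt_top hF.neg hFi.neg hθ (C := C) (fun k => ?_)
        (l := -t) (by linarith) (by linarith [ht.1])
      · simpa using this
      · filter_upwards [hC k] with y hy
        refine le_trans (le_of_eq ?_) hy
        refine lintegral_congr fun x => ?_
        have : coordMean μ k (-F) y = -coordMean μ k F y := by
          simp [coordMean, integral_neg]
        rw [this, Pi.neg_apply, ← abs_neg]
        ring_nf
    · subst h; simp
    · exact lintegral_exp_mul_lt_top hF hFi hθ hC h ht.2
  exact interior_maximal hsub isOpen_Ioo (abs_lt.1 hl)

end ExpIntegrable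

/-! ### Elementary inequalities for exponential functions -/

lemma entPsi_eq_sq_mul_integral (s : ℝ) :
    entPsi s = s ^ 2 * ∫ v in (0 : ℝ)..1, v * Real.exp (s * v) := by
  have h : ∀ v ∈ Set.uIcc (0 : ℝ) 1, HasDerivAt
      (fun v => s * v * Real.exp (s * v) - Real.exp (s * v))
      (s ^ 2 * (v * Real.exp (s * v))) v := by
    intro v _
    have h1 : HasDerivAt (fun v => s * v) s v := by simpa using (hasDerivAt_id v).const_mul s
    refine ((h1.mul h1.exp).sub h1.exp).congr_deriv ?_
    ring
  have := intervalIntegral.integral_eq_sub_of_hasDerivAt h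
    (Continuous.intervalIntegrable (by fun_prop) _ _)
  rw [intervalIntegral.integral_const_mul] at this
  rw [this, entPsi]
  simp

/-- `entPsi s / s ^ 2` is nondecreasing in `s`. -/
lemma sq_mul_entPsi_le {s b : ℝ} (h : s ≤ b) : b ^ 2 * entPsi s ≤ s ^ 2 * entPsi b := by
  rw [entPsi_eq_sq_mul_integral s, entPsi_eq_sq_mul_integral b]
  have : ∫ v in (0 : ℝ)..1, v * Real.exp (s * v) ≤ ∫ v in (0 : ℝ)..1, v * Real.exp (b * v) := by
    refine intervalIntegral.integral_mono_on zero_le_one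
      (Continuous.intervalIntegrable (by fun_prop) _ _)
      (Continuous.intervalIntegrable (by fun_prop) _ _) fun v hv => ?_
    have := hv.1
    gcongr
  nlinarith [mul_le_mul_of_nonneg_left this (mul_nonneg (sq_nonneg s) (sq_nonneg b))]

/-- `entPsi s / s ^ 2` has logarithmic derivative at most one. -/
lemma entPsi_mul_le {b r : ℝ} (hb : 0 ≤ b) (hr : 1 ≤ r) :
    entPsi (b * r) ≤ r ^ 2 * Real.exp (b * (r - 1)) * entPsi b := by
  rw [entPsi_eq_sq_mul_integral (b * r), entPsi_eq_sq_mul_integral b]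
  have : ∫ v in (0 : ℝ)..1, v * Real.exp (b * r * v) ≤
      ∫ v in (0 : ℝ)..1, Real.exp (b * (r - 1)) * (v * Real.exp (b * v)) := by
    refine intervalIntegral.integral_mono_on zero_le_one
      (Continuous.intervalIntegrable (by fun_prop) _ _)
      (Continuous.intervalIntegrable (by fun_prop) _ _) fun v hv => ?_
    have hle : Real.exp (b * r * v) ≤ Real.exp (b * (r - 1)) * Real.exp (b * v) := by
      rw [← Real.exp_add]
      refine Real.exp_le_exp.2 ?_
      nlinarith [mul_nonneg (mul_nonneg hb (sub_nonneg.2 hr)) (sub_nonneg.2 hv.2)]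
    calc v * Real.exp (b * r * v) ≤ v * (Real.exp (b * (r - 1)) * Real.exp (b * v)) :=
          mul_le_mul_of_nonneg_left hle hv.1
      _ = _ := by ring
  rw [intervalIntegral.integral_const_mul] at this
  calc _ ≤ (b * r) ^ 2 * (Real.exp (b * (r - 1)) * ∫ v in (0 : ℝ)..1, v * Real.exp (b * v)) := by
        gcongr
    _ = _ := by ring

lemma exp_sub_one_le_mul_exp (s : ℝ) : Real.exp s - 1 ≤ s * Real.exp s := by
  have := entPsi_nonneg s
  unfold entPsi at this
  linarith

lemma mul_sq_le_exp {s : ℝ} (hs : 0 ≤ s) : s * (1 + s) ^ 2 ≤ Real.exp (2 * s) := by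
  have h := Real.sum_le_exp_of_nonneg (x := 2 * s) (by linarith) 4
  simp [Finset.sum_range_succ, Nat.factorial] at h
  nlinarith [pow_nonneg hs 3]

lemma sq_le_exp_two_mul {k : ℝ} (hk : 0 ≤ k) : k ^ 2 ≤ Real.exp (2 * (k - 1)) := by
  have h := Real.add_one_le_exp (k - 1)
  rw [two_mul, Real.exp_add]
  nlinarith

lemma fifty_four_le_exp_four : 54 ≤ Real.exp 4 := by
  have h := Real.exp_one_gt_d9
  have h1 : Real.exp 4 = (Real.exp 1) ^ 4 := by rw [← Real.exp_nat_mul]; norm_num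
  rw [h1]
  calc (54 : ℝ) ≤ 2.7182818283 ^ 4 := by norm_num
    _ ≤ _ := by gcongr

/-! ### Pointwise bounds by the Orlicz function -/

/-- The pointwise bound behind the cumulant estimate. Up to the level `M = zK`, the function
`entPsi (t s)` is at most `entPsi (t M) (s / M) ^ 2`, since `entPsi s / s ^ 2` is nondecreasing;
beyond that level the excess is absorbed by the Orlicz function at scale `u ≤ K`. The square of
`u` in front of the latter is what makes the bound summable over the coordinates. -/
lemma entPsi_mul_le_orliczPsi {α z K u t s : ℝ} (hα : 1 ≤ α) (hz : 0 < z) (hB : 4 ≤ z ^ α)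
    (hu : 0 < u) (huK : u ≤ K) (ht : 0 < t) (htM : t * (z * K) ≤ α * z ^ α / 2) :
    entPsi (t * s) ≤ entPsi (t * (z * K)) / (z * K) ^ 2 * s ^ 2 +
      t * (z * K) * entPsi (t * (z * K)) * (u / K) ^ 2 * (11 / 10 * Real.exp (-z ^ α)) *
        orliczPsi α (|s| / u) := by
  have hK : 0 < K := hu.trans_le huK
  set M := z * K with hM
  have hM0 : 0 < M := mul_pos hz hK
  set b := t * M with hb
  have hb0 : 0 < b := mul_pos ht hM0
  set B := z ^ α with hBdef
  have hψ := entPsi_nonneg b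
  have hor : 0 ≤ orliczPsi α (|s| / u) := by
    have : 0 ≤ (|s| / u) ^ α := Real.rpow_nonneg (by positivity) _
    have := Real.one_le_exp this
    unfold orliczPsi
    linarith
  rcases le_or_gt s M with hs | hs
  · have h1 : b ^ 2 * entPsi (t * s) ≤ (t * s) ^ 2 * entPsi b :=
      sq_mul_entPsi_le (mul_le_mul_of_nonneg_left hs ht.le)
    have h2 : entPsi (t * s) ≤ entPsi b / M ^ 2 * s ^ 2 := by
      rw [div_mul_eq_mul_div, le_div_iff₀ (by positivity)]
      have ht2 : 0 < t ^ 2 := by positivity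
      rw [hb] at h1 ⊢
      nlinarith
    have h3 : 0 ≤ b * entPsi b * (u / K) ^ 2 * (11 / 10 * Real.exp (-B)) *
        orliczPsi α (|s| / u) := by positivity
    linarith
  · set r := s / M with hr
    have hr1 : 1 < r := (one_lt_div hM0).2 hs
    have hs0 : 0 < s := hM0.trans hs
    have hsr : t * s = b * r := by rw [hb, hr]; field_simp
    set k := K / u with hk
    have hk1 : 1 ≤ k := (one_le_div hu).2 huK
    -- the Orlicz function at `s` dominates `k² e^{B + αB(r-1)}`
    set w := B * r ^ α with hw
    have hrα : 1 + α * (r - 1) ≤ r ^ α := by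
      have := one_add_mul_self_le_rpow_one_add (s := r - 1) (by linarith) hα
      simpa using this
    have hB0 : 0 < B := by linarith
    have hwB : B + α * B * (r - 1) ≤ w := by
      rw [hw]
      nlinarith [mul_le_mul_of_nonneg_left hrα hB0.le]
    have hw4 : 4 ≤ w := by
      have : 0 ≤ α * B * (r - 1) := by
        have : 0 ≤ r - 1 := by linarith
        positivity
      linarith
    have hpow : w * k ≤ (|s| / u) ^ α := by
      have e : |s| / u = z * (r * k) := by
        rw [abs_of_pos hs0, hr, hk, hM]; field_simp
      have h1 : k ≤ k ^ α := by
        simpa using Real.rpow_le_rpow_of_exponent_le hk1 hα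
      rw [e, Real.mul_rpow hz.le (by positivity), Real.mul_rpow (by linarith) (by linarith), hw,
        mul_assoc]
      gcongr
    have hψs : k ^ 2 * (10 / 11 * Real.exp w) ≤ orliczPsi α (|s| / u) := by
      have h1 : Real.exp (w * k) = Real.exp (w * (k - 1)) * Real.exp w := by
        rw [← Real.exp_add]; ring_nf
      have h2 : 1 ≤ Real.exp (w * (k - 1)) :=
        Real.one_le_exp (mul_nonneg (by linarith) (by linarith))
      have h3 : k ^ 2 ≤ Real.exp (w * (k - 1)) := by
        refine (sq_le_exp_two_mul (by linarith)).trans (Real.exp_le_exp.2 ?_)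
        nlinarith
      have h4 : 10 / 11 * Real.exp w ≤ Real.exp w - 1 := by
        have := Real.exp_le_exp.2 hw4
        linarith [fifty_four_le_exp_four]
      have h5 : (0 : ℝ) ≤ 10 / 11 * Real.exp w := by positivity
      calc k ^ 2 * (10 / 11 * Real.exp w) ≤ Real.exp (w * (k - 1)) * (Real.exp w - 1) :=
            mul_le_mul h3 h4 h5 (by positivity)
        _ ≤ Real.exp (w * k) - 1 := by rw [h1]; linarith
        _ ≤ _ := by
            unfold orliczPsi
            have := Real.exp_le_exp.2 hpow
            linarith
    have hkey : r ^ 2 * Real.exp (b * (r - 1)) ≤ r ^ 2 + b * Real.exp (-B + w) := by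
      have h1 : Real.exp (b * (r - 1)) - 1 ≤ b * (r - 1) * Real.exp (b * (r - 1)) :=
        exp_sub_one_le_mul_exp _
      have h2 : (r - 1) * r ^ 2 ≤ Real.exp (2 * (r - 1)) := by
        have := mul_sq_le_exp (s := r - 1) (by linarith)
        simpa using this
      have h3 : Real.exp (2 * (r - 1)) * Real.exp (b * (r - 1)) ≤ Real.exp (-B + w) := by
        rw [← Real.exp_add]
        refine Real.exp_le_exp.2 ?_
        have h4 : b + 2 ≤ α * B := by nlinarith
        have : 0 ≤ (r - 1) * (α * B - (b + 2)) :=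
          mul_nonneg (by linarith) (by linarith)
        nlinarith
      have h5 : (r - 1) * r ^ 2 * Real.exp (b * (r - 1)) ≤ Real.exp (-B + w) :=
        (mul_le_mul_of_nonneg_right h2 (Real.exp_pos _).le).trans h3
      nlinarith [mul_le_mul_of_nonneg_left h1 (sq_nonneg r), mul_le_mul_of_nonneg_left h5 hb0.le]
    rw [hsr]
    refine (entPsi_mul_le hb0.le hr1.le).trans ?_
    have h6 : entPsi b / M ^ 2 * s ^ 2 = r ^ 2 * entPsi b := by rw [hr]; field_simp
    have h7 : b * Real.exp (-B + w) ≤ b * (u / K) ^ 2 * (11 / 10 * Real.exp (-B)) *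
        orliczPsi α (|s| / u) := by
      calc b * Real.exp (-B + w)
          = b * (u / K) ^ 2 * (11 / 10 * Real.exp (-B)) * (k ^ 2 * (10 / 11 * Real.exp w)) := by
            rw [Real.exp_add, hk]; field_simp
        _ ≤ _ := by gcongr
    rw [h6]
    calc _ ≤ (r ^ 2 + b * (u / K) ^ 2 * (11 / 10 * Real.exp (-B)) *
          orliczPsi α (|s| / u)) * entPsi b := by
          gcongr
          linarith
      _ = _ := by ring

lemma exp_mul_abs_le_orliczPsi {α z K s : ℝ} (hα : 1 ≤ α) (hz : 0 < z) (hK : 0 < K) :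
    Real.exp (α * z ^ α / (z * K) * |s|) ≤
      Real.exp (α * z ^ α) * (orliczPsi α (|s| / K) + 1) := by
  have hB0 : 0 < z ^ α := Real.rpow_pos_of_pos hz _
  set r := |s| / (z * K) with hr
  have hr0 : 0 ≤ r := by positivity
  have hrα : 1 + α * (r - 1) ≤ r ^ α := by
    have := one_add_mul_self_le_rpow_one_add (s := r - 1) (by linarith) hα
    simpa using this
  have e : (|s| / K) ^ α = z ^ α * r ^ α := by
    rw [← Real.mul_rpow hz.le hr0]
    congr 1
    rw [hr]; field_simp
  have e2 : α * z ^ α / (z * K) * |s| = α * z ^ α * r := by rw [hr]; field_simp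
  rw [orliczPsi, sub_add_cancel, e, e2, ← Real.exp_add]
  refine Real.exp_le_exp.2 ?_
  nlinarith [mul_le_mul_of_nonneg_left hrα hB0.le]

/-! ### The Orlicz norm -/

lemma measurable_orliczPsi (α u : ℝ) : Measurable fun s : ℝ => orliczPsi α (|s| / u) := by
  unfold orliczPsi
  fun_prop

lemma orliczPsi_anti {α : ℝ} (hα : 0 ≤ α) {t v : ℝ} (ht : 0 < t) (htv : t ≤ v) (s : ℝ) :
    orliczPsi α (|s| / v) ≤ orliczPsi α (|s| / t) := by
  unfold orliczPsi
  have : 0 < v := ht.trans_le htv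
  gcongr

/-- The infimum defining the Orlicz norm is attained if it is positive and finite. -/
lemma lintegral_orliczPsi_le_one {α : ℝ} (hα : 1 ≤ α) {ν : Measure ℝ} {u : ℝ} (hu : 0 < u)
    (h : orliczNorm α ν ≤ ENNReal.ofReal u) :
    ∫⁻ s, ENNReal.ofReal (orliczPsi α (|s| / u)) ∂ν ≤ 1 := by
  have hgt : ∀ v : ℝ, u < v → ∫⁻ s, ENNReal.ofReal (orliczPsi α (|s| / v)) ∂ν ≤ 1 := by
    intro v hv
    have hlt : orliczNorm α ν < ENNReal.ofReal v :=
      h.trans_lt ((ENNReal.ofReal_lt_ofReal_iff (hu.trans hv)).2 hv)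
    obtain ⟨_, ⟨t, ⟨ht0, ht⟩, rfl⟩, htv⟩ := sInf_lt_iff.1 hlt
    have htv' : t < v := (ENNReal.ofReal_lt_ofReal_iff (hu.trans hv)).1 htv
    refine le_trans (lintegral_mono fun s => ENNReal.ofReal_le_ofReal ?_) ht
    exact orliczPsi_anti (by linarith) ht0 htv'.le s
  have hv : ∀ j : ℕ, u < u + 1 / ((j : ℝ) + 1) := fun j => by
    have : 0 < 1 / ((j : ℝ) + 1) := Nat.one_div_pos_of_nat
    linarith
  have hlim : ∀ s : ℝ, Filter.Tendsto
      (fun j : ℕ => ENNReal.ofReal (orliczPsi α (|s| / (u + 1 / ((j : ℝ) + 1)))))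
      Filter.atTop (nhds (ENNReal.ofReal (orliczPsi α (|s| / u)))) := by
    intro s
    have h1 : Filter.Tendsto (fun j : ℕ => u + 1 / ((j : ℝ) + 1)) Filter.atTop (nhds (u + 0)) :=
      tendsto_const_nhds.add tendsto_one_div_add_atTop_nhds_zero_nat
    rw [add_zero] at h1
    have h2 := (tendsto_const_nhds (x := |s|)).div h1 hu.ne'
    have h3 := h2.rpow_const (p := α) (Or.inr (by linarith))
    exact ENNReal.tendsto_ofReal ((Real.continuous_exp.tendsto _ |>.comp h3).sub_const 1)
  calc ∫⁻ s, ENNReal.ofReal (orliczPsi α (|s| / u)) ∂ν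
      = ∫⁻ s, Filter.liminf (fun j : ℕ =>
          ENNReal.ofReal (orliczPsi α (|s| / (u + 1 / ((j : ℝ) + 1))))) Filter.atTop ∂ν :=
        lintegral_congr fun s => ((hlim s).liminf_eq).symm
    _ ≤ Filter.liminf (fun j : ℕ => ∫⁻ s,
          ENNReal.ofReal (orliczPsi α (|s| / (u + 1 / ((j : ℝ) + 1)))) ∂ν) Filter.atTop :=
        lintegral_liminf_le fun j => (measurable_orliczPsi α _).ennreal_ofReal
    _ ≤ 1 := Filter.liminf_le_of_le ⟨0, by simp⟩ fun b hb => by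
        obtain ⟨j, hj⟩ := hb.exists
        exact hj.trans (hgt _ (hv j))

lemma four_le_zParam_rpow {α : ℝ} (hα : 1 ≤ α) (U σ : ℝ) :
    zParam U σ α ^ α = 4 * ulog (Real.exp 1 * U / σ) ∧ 4 ≤ zParam U σ α ^ α ∧
      0 < zParam U σ α ∧ zParam U σ α ≤ zParam U σ α ^ α := by
  have h1 : 1 ≤ ulog (Real.exp 1 * U / σ) := le_max_right _ _
  have h2 : zParam U σ α ^ α = 4 * ulog (Real.exp 1 * U / σ) := by
    rw [zParam, ← Real.rpow_mul (by linarith), one_div, inv_mul_cancel₀ (by linarith),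
      Real.rpow_one]
  have h3 : 1 ≤ zParam U σ α := Real.one_le_rpow (by linarith) (by positivity)
  refine ⟨h2, by rw [h2]; linarith, by linarith, ?_⟩
  simpa using Real.rpow_le_rpow_of_exponent_le h3 hα

/-- The choice of the truncation level makes the contribution of the tails negligible. -/
lemma sq_mul_tail_le {α U σ : ℝ} (hα : 1 ≤ α) (hU : 0 < U) (hσ : 0 < σ) :
    U ^ 2 * zParam U σ α ^ 2 * (121 / 100 * Real.exp (-zParam U σ α ^ α)) ≤ 5 / 12 * σ ^ 2 := by
  obtain ⟨hB, hB4, hz, hzB⟩ := four_le_zParam_rpow hα U σ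
  set z := zParam U σ α
  set B := z ^ α
  have hU2 : U ^ 2 ≤ σ ^ 2 * Real.exp (B / 2 - 2) := by
    have h1 : Real.log (Real.exp 1 * U / σ) ≤ B / 4 := by
      rw [hB]
      have := le_max_left (Real.log (Real.exp 1 * U / σ)) 1
      unfold ulog
      linarith
    rw [Real.log_le_iff_le_exp (by positivity), div_le_iff₀ hσ] at h1
    have h2 : U ≤ σ * Real.exp (B / 4 - 1) := by
      rw [Real.exp_sub, mul_div_assoc', le_div_iff₀ (Real.exp_pos 1)]
      linarith
    calc U ^ 2 ≤ (σ * Real.exp (B / 4 - 1)) ^ 2 := by gcongr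
      _ = _ := by rw [mul_pow, ← Real.exp_nat_mul]; congr 2; push_cast; ring
  have hz2 : z ^ 2 ≤ 16 * Real.exp (B / 2 - 2) := by
    have h1 := sq_le_exp_two_mul (k := B / 4) (by linarith)
    have h2 : 2 * (B / 4 - 1) = B / 2 - 2 := by ring
    rw [h2] at h1
    have h3 : z ^ 2 ≤ B ^ 2 := by gcongr
    nlinarith
  calc U ^ 2 * z ^ 2 * (121 / 100 * Real.exp (-B))
      ≤ σ ^ 2 * Real.exp (B / 2 - 2) * (16 * Real.exp (B / 2 - 2)) *
        (121 / 100 * Real.exp (-B)) := by gcongr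
    _ = σ ^ 2 * (16 * (121 / 100) * Real.exp (-4)) := by
        have : Real.exp (B / 2 - 2) * Real.exp (B / 2 - 2) * Real.exp (-B) = Real.exp (-4) := by
          rw [← Real.exp_add, ← Real.exp_add]; ring_nf
        rw [← this]; ring
    _ ≤ σ ^ 2 * (5 / 12) := by
        gcongr
        rw [Real.exp_neg, ← div_eq_mul_inv, div_le_iff₀ (Real.exp_pos 4)]
        linarith [fifty_four_le_exp_four]
    _ = _ := by ring

/-- The entropy bound for a family of laws with prescribed Orlicz norms and variances. -/
theorem sum_lintegral_entPsi_le {n : ℕ} {ν : Fin n → Measure ℝ} {α K U σ t : ℝ} (hα : 1 ≤ α)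
    (hK : 0 < K) (hKU : K ≤ U) (hσ : 0 < σ) (hmax : ∀ k, orliczNorm α (ν k) ≤ ENNReal.ofReal K)
    (hsumU : ∑ k, orliczNorm α (ν k) ^ 2 ≤ ENNReal.ofReal (U ^ 2))
    (hsumσ : ∑ k, ∫⁻ s, ENNReal.ofReal (s ^ 2) ∂ν k ≤ ENNReal.ofReal (σ ^ 2)) (ht : 0 < t)
    (htM : t * (zParam U σ α * K) ≤ α * zParam U σ α ^ α / 2) :
    ∑ k, ∫⁻ s, ENNReal.ofReal (entPsi (t * s)) ∂ν k ≤
      ENNReal.ofReal (σ ^ 2 / (zParam U σ α * K) ^ 2 *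
        ((1 + 5 / 12 * (t * (zParam U σ α * K))) * entPsi (t * (zParam U σ α * K)))) := by
  have htail := sq_mul_tail_le hα (hK.trans_le hKU) hσ
  obtain ⟨-, hB4, hz, -⟩ := four_le_zParam_rpow hα U σ
  set z := zParam U σ α
  set M := z * K with hM
  have hM0 : 0 < M := mul_pos hz hK
  have hψ := entPsi_nonneg (t * M)
  have hU : 0 < U := hK.trans_le hKU
  -- scales bounded away from zero, at the price of a tenth of `U ^ 2`
  set N : Fin n → ℝ := fun k => (orliczNorm α (ν k)).toReal with hN
  have hNfin : ∀ k, orliczNorm α (ν k) ≠ ∞ := fun k => ((hmax k).trans_lt ENNReal.ofReal_lt_top).ne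
  have hN0 : ∀ k, 0 ≤ N k := fun k => ENNReal.toReal_nonneg
  set ε : ℝ := K / Real.sqrt (10 * (n + 1)) with hε
  have hε0 : 0 < ε := by positivity
  have hεK : ε ≤ K := by
    refine div_le_self hK.le (Real.one_le_sqrt.2 ?_)
    have : (0 : ℝ) ≤ n := n.cast_nonneg
    linarith
  have hε2 : n * ε ^ 2 ≤ U ^ 2 / 10 := by
    rw [hε, div_pow, Real.sq_sqrt (by positivity)]
    have h1 : K ^ 2 ≤ U ^ 2 := by gcongr
    rw [mul_div_assoc', div_le_div_iff₀ (by positivity) (by norm_num)]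
    have : (0 : ℝ) ≤ n := n.cast_nonneg
    nlinarith
  set u : Fin n → ℝ := fun k => max (N k) ε with hu_def
  have hu0 : ∀ k, 0 < u k := fun k => hε0.trans_le (le_max_right _ _)
  have huK : ∀ k, u k ≤ K := fun k =>
    max_le (ENNReal.toReal_le_of_le_ofReal hK.le (hmax k)) hεK
  have hNu : ∀ k, orliczNorm α (ν k) ≤ ENNReal.ofReal (u k) := fun k => by
    rw [← ENNReal.ofReal_toReal (hNfin k)]
    exact ENNReal.ofReal_le_ofReal (le_max_left _ _)
  have husum : ∑ k, u k ^ 2 ≤ 11 / 10 * U ^ 2 := by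
    have h1 : ∑ k, N k ^ 2 ≤ U ^ 2 := by
      have : ∑ k, N k ^ 2 = (∑ k, orliczNorm α (ν k) ^ 2).toReal := by
        rw [ENNReal.toReal_sum fun k _ => ENNReal.pow_ne_top (hNfin k)]
        simp [hN]
      rw [this]
      exact ENNReal.toReal_le_of_le_ofReal (by positivity) hsumU
    have h2 : ∀ k, u k ^ 2 ≤ N k ^ 2 + ε ^ 2 := fun k => by
      rcases max_choice (N k) ε with h | h <;> simp only [hu_def, h] <;> nlinarith [hN0 k]
    calc ∑ k, u k ^ 2 ≤ ∑ k, (N k ^ 2 + ε ^ 2) := Finset.sum_le_sum fun k _ => h2 k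
      _ = ∑ k, N k ^ 2 + n * ε ^ 2 := by simp [Finset.sum_add_distrib]
      _ ≤ _ := by linarith
  set c := t * M * entPsi (t * M) * (11 / 10 * Real.exp (-z ^ α)) / K ^ 2 with hc
  have hc0 : 0 ≤ c := by positivity
  have hk : ∀ k, ∫⁻ s, ENNReal.ofReal (entPsi (t * s)) ∂ν k ≤
      ENNReal.ofReal (entPsi (t * M) / M ^ 2) * ∫⁻ s, ENNReal.ofReal (s ^ 2) ∂ν k +
        ENNReal.ofReal (c * u k ^ 2) := by
    intro k
    have hpt : ∀ s, ENNReal.ofReal (entPsi (t * s)) ≤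
        ENNReal.ofReal (entPsi (t * M) / M ^ 2) * ENNReal.ofReal (s ^ 2) +
          ENNReal.ofReal (c * u k ^ 2) * ENNReal.ofReal (orliczPsi α (|s| / u k)) := by
      intro s
      have hor : 0 ≤ orliczPsi α (|s| / u k) := by
        have : 0 ≤ (|s| / u k) ^ α := Real.rpow_nonneg (div_nonneg (abs_nonneg s) (hu0 k).le) _
        have := Real.one_le_exp this
        unfold orliczPsi
        linarith
      rw [← ENNReal.ofReal_mul (by positivity), ← ENNReal.ofReal_mul (by positivity),
        ← ENNReal.ofReal_add (by positivity) (by positivity)]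
      refine ENNReal.ofReal_le_ofReal ?_
      refine (entPsi_mul_le_orliczPsi (s := s) hα hz hB4 (hu0 k) (huK k) ht htM).trans
        (le_of_eq ?_)
      simp only [← hM, hc]
      field_simp
    refine (lintegral_mono hpt).trans ?_
    rw [lintegral_add_left (by fun_prop), lintegral_const_mul' _ _ ENNReal.ofReal_ne_top,
      lintegral_const_mul' _ _ ENNReal.ofReal_ne_top]
    gcongr
    calc _ ≤ ENNReal.ofReal (c * u k ^ 2) * 1 := by
          gcongr
          exact lintegral_orliczPsi_le_one hα (hu0 k) (hNu k)
      _ = _ := mul_one _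
  refine (Finset.sum_le_sum fun k _ => hk k).trans ?_
  rw [Finset.sum_add_distrib, ← Finset.mul_sum, ← ENNReal.ofReal_sum_of_nonneg
    (fun k _ => by positivity), ← Finset.mul_sum]
  calc _ ≤ ENNReal.ofReal (entPsi (t * M) / M ^ 2) * ENNReal.ofReal (σ ^ 2) +
        ENNReal.ofReal (c * (11 / 10 * U ^ 2)) := by gcongr
    _ = ENNReal.ofReal (entPsi (t * M) / M ^ 2 * σ ^ 2 + c * (11 / 10 * U ^ 2)) := by
        rw [← ENNReal.ofReal_mul (by positivity), ← ENNReal.ofReal_add (by positivity)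
          (by positivity)]
    _ ≤ _ := by
        refine ENNReal.ofReal_le_ofReal ?_
        have h1 : c * (11 / 10 * U ^ 2) = t * M * entPsi (t * M) / M ^ 2 *
            (U ^ 2 * z ^ 2 * (121 / 100 * Real.exp (-z ^ α))) := by
          rw [hc, hM]; field_simp; ring
        have h2 : t * M * entPsi (t * M) / M ^ 2 *
            (U ^ 2 * z ^ 2 * (121 / 100 * Real.exp (-z ^ α))) ≤
            t * M * entPsi (t * M) / M ^ 2 * (5 / 12 * σ ^ 2) := by gcongr
        rw [h1]
        refine (add_le_add_right h2 _).trans (le_of_eq ?_)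
        field_simp

/-- Uniform exponential moments of a law with bounded Orlicz norm. -/
lemma lintegral_exp_mul_abs_le {ν : Measure ℝ} [IsProbabilityMeasure ν] {α z K : ℝ} (hα : 1 ≤ α)
    (hz : 0 < z) (hK : 0 < K) (h : orliczNorm α ν ≤ ENNReal.ofReal K) :
    ∫⁻ s, ENNReal.ofReal (Real.exp (α * z ^ α / (z * K) * |s|)) ∂ν ≤
      ENNReal.ofReal (Real.exp (α * z ^ α) * 2) := by
  have h1 := lintegral_orliczPsi_le_one hα hK h
  have hor : ∀ s : ℝ, 0 ≤ orliczPsi α (|s| / K) := fun s => by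
    have : 0 ≤ (|s| / K) ^ α := Real.rpow_nonneg (by positivity) _
    have := Real.one_le_exp this
    unfold orliczPsi
    linarith
  calc _ ≤ ∫⁻ s, ENNReal.ofReal (Real.exp (α * z ^ α)) *
        (ENNReal.ofReal (orliczPsi α (|s| / K)) + 1) ∂ν := by
        refine lintegral_mono fun s => ?_
        rw [← ENNReal.ofReal_one, ← ENNReal.ofReal_add (hor s) zero_le_one,
          ← ENNReal.ofReal_mul (Real.exp_pos _).le]
        exact ENNReal.ofReal_le_ofReal (exp_mul_abs_le_orliczPsi hα hz hK)
    _ = ENNReal.ofReal (Real.exp (α * z ^ α)) *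
        (∫⁻ s, ENNReal.ofReal (orliczPsi α (|s| / K)) ∂ν + 1) := by
        rw [lintegral_const_mul' _ _ ENNReal.ofReal_ne_top, lintegral_add_right _ measurable_const]
        simp
    _ ≤ ENNReal.ofReal (Real.exp (α * z ^ α)) * (1 + 1) := by gcongr
    _ = _ := by
        rw [ENNReal.ofReal_mul (Real.exp_pos _).le, one_add_one_eq_two]
        simp

/-! ### The cumulant bound of Bennett type and its Chernoff optimization -/

/-- The function `a ↦ e^a - 1 - a` of Bennett's inequality. -/
noncomputable def expPhi (a : ℝ) : ℝ := Real.exp a - 1 - a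

lemma expPhi_nonneg (a : ℝ) : 0 ≤ expPhi a := by
  have := Real.add_one_le_exp a
  unfold expPhi
  linarith

lemma hasDerivAt_expPhi_mul_div (M : ℝ) {t : ℝ} (ht : t ≠ 0) :
    HasDerivAt (fun t => expPhi (t * M) / t) (entPsi (t * M) / t ^ 2) t := by
  have h1 : HasDerivAt (fun t : ℝ => t * M) M t := by simpa using (hasDerivAt_id t).mul_const M
  have h2 : HasDerivAt (fun t => expPhi (t * M)) (Real.exp (t * M) * M - M) t :=
    (h1.exp.sub_const 1).sub h1
  refine (h2.div (hasDerivAt_id t) ht).congr_deriv ?_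
  simp only [id, entPsi, expPhi]
  ring

lemma tendsto_expPhi_mul_div (M : ℝ) :
    Filter.Tendsto (fun t => expPhi (t * M) / t) (nhdsWithin 0 (Set.Ioi 0)) (nhds 0) := by
  have h1 : HasDerivAt (fun t : ℝ => t * M) M 0 := by
    simpa using (hasDerivAt_id (0 : ℝ)).mul_const M
  have h2 : HasDerivAt (fun t => expPhi (t * M)) 0 0 :=
    ((h1.exp.sub_const 1).sub h1).congr_deriv (by simp)
  refine (h2.tendsto_slope_zero.mono_left
    (nhdsWithin_mono 0 fun s hs => (ne_of_gt hs : s ≠ 0))).congr fun s => ?_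
  simp [expPhi, div_eq_inv_mul]

section Cumulant

variable {n : ℕ} {X : Fin n → Type*} [∀ i, MeasurableSpace (X i)]
  {μ : ∀ i, Measure (X i)} [∀ i, IsProbabilityMeasure (μ i)]

theorem cgf_le_bennett {F : (∀ i, X i) → ℝ} (hF : Measurable F)
    (hFi : Integrable F (Measure.pi μ)) {M v θ C l : ℝ} (hM : 0 ≤ M) (hv : 0 ≤ v)
    (hC : ∀ k, ∀ᵐ y ∂Measure.pi μ, ∫⁻ x, ENNReal.ofReal
      (Real.exp (θ * |F (Function.update y k x) - coordMean μ k F y|)) ∂μ k ≤ ENNReal.ofReal C)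
    (hl : 0 < l) (hlθ : l < θ)
    (hG : ∀ t ∈ Set.Ioc 0 l, ∀ᵐ y ∂Measure.pi μ, ∑ k, ∫⁻ x, ENNReal.ofReal
      (entPsi (t * (F (Function.update y k x) - coordMean μ k F y))) ∂μ k ≤
        ENNReal.ofReal (v * ((1 + 5 / 12 * (t * M)) * entPsi (t * M)))) :
    l ∈ integrableExpSet F (Measure.pi μ) ∧ cgf F (Measure.pi μ) l ≤
      l * ∫ y, F y ∂Measure.pi μ + v * ((1 + 5 / 12 * (l * M)) * expPhi (l * M)) := by
  have hθ : 0 < θ := hl.trans hlθ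
  have hint : ∀ t ∈ Set.Icc 0 l, t ∈ interior (integrableExpSet F (Measure.pi μ)) := fun t ht =>
    mem_interior_integrableExpSet_of_section hF hFi hθ hC
      (by rw [abs_of_nonneg ht.1]; linarith [ht.2])
  refine ⟨interior_subset (hint l ⟨hl.le, le_rfl⟩), ?_⟩
  set A := v * (1 + 5 / 12 * (l * M)) with hA
  have hA0 : 0 ≤ A := by positivity
  have h := cgf_le_of_sum_entPsi_le hF hl hint
    (Γ := fun t => A * (expPhi (t * M) / t)) (Γ' := fun t => A * (entPsi (t * M) / t ^ 2))
    (fun t ht => (hasDerivAt_expPhi_mul_div M ht.1.ne').const_mul A)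
    (fun t ht => mul_nonneg hA0 (div_nonneg (entPsi_nonneg _) (sq_nonneg t)))
    (by simpa using (tendsto_expPhi_mul_div M).const_mul A) ?_
  · refine h.trans (le_of_eq ?_)
    rw [hA]
    field_simp
  · intro t ht
    filter_upwards [hG t ht] with y hy
    refine hy.trans (ENNReal.ofReal_le_ofReal ?_)
    have ht0 := ht.1
    have h1 : t ^ 2 * (A * (entPsi (t * M) / t ^ 2)) = A * entPsi (t * M) := by field_simp
    rw [h1, hA, ← mul_assoc]
    have := entPsi_nonneg (t * M)
    have := ht.2
    gcongr

end Cumulant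

lemma expPhi_mul_le_sq {a : ℝ} (ha : 0 ≤ a) : expPhi a * (2 * (1 - a / 3)) ≤ a ^ 2 := by
  have hk : ∀ s : ℝ, 0 ≤ s → 0 ≤ (s - 2) * Real.exp s + s + 2 := by
    intro s hs
    have hd : ∀ s, HasDerivAt (fun s => (s - 2) * Real.exp s + s + 2) (entPsi s) s := by
      intro s
      refine (((((hasDerivAt_id s).sub_const 2).mul (Real.hasDerivAt_exp s)).add
        (hasDerivAt_id s)).add_const 2).congr_deriv ?_
      simp only [id, entPsi]; ring
    have := monotone_of_hasDerivAt_nonneg hd fun s => entPsi_nonneg s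
    simpa using this hs
  have hd : ∀ s, HasDerivAt (fun s => s ^ 2 - (Real.exp s - 1 - s) * (2 * (1 - s / 3)))
      (2 / 3 * ((s - 2) * Real.exp s + s + 2)) s := by
    intro s
    refine ((hasDerivAt_pow 2 s).sub ((((Real.hasDerivAt_exp s).sub_const 1).sub
      (hasDerivAt_id s)).mul ((((hasDerivAt_id s).div_const 3).const_sub 1).const_mul
        2))).congr_deriv ?_
    simp only [id, Pi.sub_apply]; push_cast; ring
  have hmono : MonotoneOn (fun s => s ^ 2 - (Real.exp s - 1 - s) * (2 * (1 - s / 3)))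
      (Set.Ici 0) := by
    refine monotoneOn_of_deriv_nonneg (convex_Ici 0)
      (fun s _ => (hd s).continuousAt.continuousWithinAt)
      (fun s _ => (hd s).differentiableAt.differentiableWithinAt) fun s hs => ?_
    rw [(hd s).deriv]
    exact mul_nonneg (by norm_num) (hk s (interior_subset hs))
  have := hmono (Set.mem_Ici.2 le_rfl) (Set.mem_Ici.2 ha) ha
  simp only [expPhi]
  norm_num at this
  linarith

/-- Bernstein's choice of the parameter. The constant `3 / 8` is half of `3 / 4 = 1 / 3 + 5 / 12`,
where `1 / 3` comes from `expPhi_mul_le_sq` and `5 / 12` from the factor `1 + 5 / 12 * a`. -/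
lemma exists_bernstein {w : ℝ} (hw : 0 < w) : ∃ a, 0 < a ∧ a < 4 / 3 ∧
    (1 + 5 / 12 * a) * expPhi a + w ^ 2 / 2 ≤ a * (w + 3 / 8 * w ^ 2) := by
  have hd : 0 < 1 + 3 / 4 * w := by positivity
  set a := w / (1 + 3 / 4 * w) with ha
  have ha0 : 0 < a := by positivity
  have haw : a * (1 + 3 / 4 * w) = w := by rw [ha]; field_simp
  have ha43 : a < 4 / 3 := by
    rw [ha, div_lt_iff₀ hd]; linarith
  refine ⟨a, ha0, ha43, ?_⟩
  have h1 := expPhi_mul_le_sq ha0.le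
  have hφ := expPhi_nonneg a
  have h2 : (1 + 5 / 12 * a) * (1 - 3 / 4 * a) ≤ 1 - a / 3 := by nlinarith [sq_nonneg a]
  have h3 : (1 - 3 / 4 * a) * (1 + 3 / 4 * w) = 1 := by linarith
  have h4 : (1 + 5 / 12 * a) * expPhi a * (2 * (1 - 3 / 4 * a)) ≤ a ^ 2 := by
    nlinarith [mul_le_mul_of_nonneg_left h2 hφ]
  have h5 : (1 + 5 / 12 * a) * expPhi a * 2 ≤ a ^ 2 * (1 + 3 / 4 * w) := by
    calc (1 + 5 / 12 * a) * expPhi a * 2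
        = (1 + 5 / 12 * a) * expPhi a * (2 * (1 - 3 / 4 * a)) * (1 + 3 / 4 * w) := by
          linear_combination (-2 * ((1 + 5 / 12 * a) * expPhi a)) * h3
      _ ≤ _ := by gcongr
  have h6 : a ^ 2 * (1 + 3 / 4 * w) = a * w := by rw [sq, mul_assoc, haw]
  have h7 : w ^ 2 = a * (w + 3 / 4 * w ^ 2) := by
    calc w ^ 2 = a * (1 + 3 / 4 * w) * w := by rw [haw, sq]
      _ = _ := by ring
  nlinarith

/-- For large deviations the linear term may be taken as large as the deviation allows. -/
lemma bennett_large {a w : ℝ} (ha : 4 / 3 ≤ a) (hw : 0 ≤ w)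
    (h : Real.exp (4 * a) ≤ w ^ 2 / 2) : (1 + 5 / 12 * a) * expPhi a ≤ a * w := by
  have h1 : Real.exp (2 * a) ≤ w := by
    refine abs_le_of_sq_le_sq' ?_ hw |>.2
    rw [← Real.exp_nat_mul]
    have : ((2 : ℕ) : ℝ) * (2 * a) = 4 * a := by push_cast; ring
    rw [this]
    nlinarith [Real.exp_pos (4 * a)]
  have h2 : expPhi a ≤ Real.exp a := by unfold expPhi; linarith
  have h3 : 1 + 5 / 12 * a ≤ a * Real.exp a := by
    have := Real.add_one_le_exp a
    nlinarith
  calc (1 + 5 / 12 * a) * expPhi a ≤ (a * Real.exp a) * Real.exp a := by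
        gcongr
        exact expPhi_nonneg a
    _ = a * Real.exp (2 * a) := by rw [two_mul, Real.exp_add]; ring
    _ ≤ a * w := by gcongr

section Deviation

variable {Ω : Type*} [MeasurableSpace Ω] {P : Measure Ω} [IsProbabilityMeasure P]

lemma one_sub_exp_le_of_cgf {W : Ω → ℝ} (hW : Measurable W) {l x m s : ℝ} (hl : 0 ≤ l)
    (hint : l ∈ integrableExpSet W P) (hc : cgf W P l + x ≤ l * (m + s)) :
    1 - Real.exp (-x) ≤ P.real {ω | W ω - m ≤ s} := by
  have h1 := measure_ge_le_exp_cgf (m + s) hl (integrable_of_mem_integrableExpSet hint)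
  have h2 : Real.exp (-l * (m + s) + cgf W P l) ≤ Real.exp (-x) :=
    Real.exp_le_exp.2 (by linarith)
  have hms : MeasurableSet {ω | W ω - m ≤ s} := measurableSet_le (hW.sub_const m) measurable_const
  have h3 : P.real {ω | W ω - m ≤ s}ᶜ ≤ P.real {ω | m + s ≤ W ω} := by
    refine measureReal_mono fun ω hω => ?_
    simp only [Set.mem_compl_iff, Set.mem_ofPred_eq, not_le] at hω ⊢
    linarith
  rw [probReal_compl_eq_one_sub hms] at h3
  linarith

/-- The two deviation bounds which follow from the cumulant bound on `(0, c / M]`. -/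
theorem deviation_of_cgf_le {W : Ω → ℝ} (hW : Measurable W) {M σ x m c : ℝ} (hM : 0 < M)
    (hσ : 0 < σ) (hx : 0 < x) (hc : 2 ≤ c)
    (hcgf : ∀ l, 0 < l → l * M ≤ c → l ∈ integrableExpSet W P ∧ cgf W P l ≤
      l * m + σ ^ 2 / M ^ 2 * ((1 + 5 / 12 * (l * M)) * expPhi (l * M))) :
    1 - Real.exp (-x) ≤ P.real {ω | W ω - m ≤ σ * Real.sqrt (2 * x) + 3 / 4 * M * x} ∧
      ∀ q, 16 / 3 ≤ q → q ≤ 4 * c → Real.exp q ≤ (M / σ) ^ 2 * x →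
        1 - Real.exp (-x) ≤ P.real {ω | W ω - m ≤ σ * Real.sqrt (2 * x) + 4 * M * x / q} := by
  set w := M * Real.sqrt (2 * x) / σ with hw
  have hw0 : 0 < w := by positivity
  have hw2 : w ^ 2 = 2 * ((M / σ) ^ 2 * x) := by
    rw [hw, div_pow, mul_pow, Real.sq_sqrt (by positivity)]; ring
  have hxw : x = σ ^ 2 / M ^ 2 * (w ^ 2 / 2) := by rw [hw2]; field_simp
  have hsw : σ * Real.sqrt (2 * x) = σ ^ 2 / M ^ 2 * w * M := by rw [hw]; field_simp
  constructor
  · obtain ⟨a, ha0, ha, h⟩ := exists_bernstein hw0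
    have haM : a / M * M = a := by field_simp
    obtain ⟨hi, hl⟩ := hcgf (a / M) (by positivity) (by rw [haM]; linarith)
    refine one_sub_exp_le_of_cgf hW (by positivity) hi ?_
    rw [haM] at hl
    have h1 : a / M * (σ * Real.sqrt (2 * x) + 3 / 4 * M * x) =
        σ ^ 2 / M ^ 2 * (a * (w + 3 / 8 * w ^ 2)) := by
      rw [hsw]
      nth_rewrite 1 [hxw]
      field_simp
      ring
    have h2 : σ ^ 2 / M ^ 2 * ((1 + 5 / 12 * a) * expPhi a + w ^ 2 / 2) ≤
        σ ^ 2 / M ^ 2 * (a * (w + 3 / 8 * w ^ 2)) := by gcongr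
    rw [mul_add, h1]
    rw [mul_add, ← hxw] at h2
    linarith
  · intro q hq hqc hexp
    have hq0 : 0 < q := by linarith
    have haM : q / 4 / M * M = q / 4 := by field_simp
    obtain ⟨hi, hl⟩ := hcgf (q / 4 / M) (by positivity) (by rw [haM]; linarith)
    refine one_sub_exp_le_of_cgf hW (by positivity) hi ?_
    rw [haM] at hl
    have hb := bennett_large (a := q / 4) (w := w) (by linarith) hw0.le (by
      rw [hw2]
      calc _ = Real.exp q := by ring_nf
        _ ≤ _ := hexp
        _ = _ := by ring)
    have h1 : q / 4 / M * (σ * Real.sqrt (2 * x) + 4 * M * x / q) =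
        σ ^ 2 / M ^ 2 * (q / 4 * w) + x := by
      rw [hsw]
      field_simp
    have h2 : σ ^ 2 / M ^ 2 * ((1 + 5 / 12 * (q / 4)) * expPhi (q / 4)) ≤
        σ ^ 2 / M ^ 2 * (q / 4 * w) := by gcongr
    rw [mul_add, h1]
    linarith

end Deviation

/-! ### Conditional laws given independent coordinates -/

/-- The conditional law of `Φ(T, V)` given `T`, for `V` independent of `T`, is the law of `Φ(T, V)`
with `T` frozen. -/
lemma condDistrib_ae_eq_of_indepFun {Ω β S : Type*} [MeasurableSpace Ω] [MeasurableSpace β]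
    [MeasurableSpace S] {P : Measure Ω} [IsProbabilityMeasure P] {T : Ω → β} {V : Ω → S}
    (hT : Measurable T) (hV : Measurable V) (h : IndepFun T V P) {Φ : β × S → ℝ}
    (hΦ : Measurable Φ) :
    ∀ᵐ ω ∂P, condDistrib (fun ω => Φ (T ω, V ω)) T P (T ω) =
      (P.map V).map (fun x => Φ (T ω, x)) := by
  have := Measure.isProbabilityMeasure_map (μ := P) hV.aemeasurable
  have := Measure.isProbabilityMeasure_map (μ := P) hT.aemeasurable
  set κ : Kernel β ℝ := (Kernel.id ×ₖ Kernel.const β (P.map V)).map Φ with hκ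
  have hκa : ∀ b, κ b = (P.map V).map (fun x => Φ (b, x)) := by
    intro b
    rw [hκ, Kernel.map_apply _ hΦ, Kernel.prod_apply, Kernel.id_apply, Kernel.const_apply,
      Measure.dirac_prod, Measure.map_map hΦ measurable_prodMk_left]
    rfl
  have hm : IsMarkovKernel κ := Kernel.IsMarkovKernel.map _ hΦ
  have hX : Measurable fun ω => Φ (T ω, V ω) := hΦ.comp (hT.prodMk hV)
  have heq : P.map (fun ω => (T ω, Φ (T ω, V ω))) = P.map T ⊗ₘ κ := by
    refine Measure.ext_of_lintegral _ fun g hg => ?_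
    have hg2 : Measurable fun p : β × S => g (p.1, Φ p) := hg.comp (measurable_fst.prodMk hΦ)
    rw [lintegral_map hg (hT.prodMk hX), Measure.lintegral_compProd hg]
    calc ∫⁻ ω, g (T ω, Φ (T ω, V ω)) ∂P
        = ∫⁻ p, g (p.1, Φ p) ∂(P.map fun ω => (T ω, V ω)) := by
          rw [lintegral_map hg2 (hT.prodMk hV)]
      _ = ∫⁻ b, ∫⁻ x, g (b, Φ (b, x)) ∂P.map V ∂P.map T := by
          rw [h.map_prod_eq_prod_map_map hT.aemeasurable hV.aemeasurable,
            lintegral_prod _ hg2.aemeasurable]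
      _ = _ := by
          refine lintegral_congr fun b => ?_
          have h1 : Measurable fun s => g (b, s) := hg.comp measurable_prodMk_left
          have h2 : Measurable fun x => Φ (b, x) := hΦ.comp measurable_prodMk_left
          rw [hκa, lintegral_map h1 h2]
  have hae := condDistrib_ae_eq_of_measure_eq_compProd T hX.aemeasurable heq
  filter_upwards [ae_of_ae_map hT.aemeasurable hae] with ω hω
  rw [hω, hκa]

section Coordinates

variable {Ω 𝒴 : Type*} [MeasurableSpace 𝒴] {n : ℕ} {Y : Fin n → Ω → 𝒴}

lemma measurable_update_sigmaWithout (k : Fin n) :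
    Measurable[(sigmaWithout Y k).prod inferInstance]
      (fun p : Ω × 𝒴 => Function.update (fun j => Y j p.1) k p.2) := by
  let _ : MeasurableSpace Ω := sigmaWithout Y k
  rw [measurable_pi_iff]
  intro j
  by_cases hj : j = k
  · subst hj
    simpa using measurable_snd
  · simp only [Function.update_of_ne hj]
    have hYj : Measurable (Y j) :=
      measurable_iff_comap_le.2 (le_iSup₂_of_le (f := fun j (_ : j ≠ k) =>
        MeasurableSpace.comap (Y j) inferInstance) j hj le_rfl)
    exact hYj.comp measurable_fst

variable [MeasurableSpace Ω] {P : Measure Ω}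

lemma sigmaWithout_le (hY : ∀ i, Measurable (Y i)) (k : Fin n) :
    sigmaWithout Y k ≤ (inferInstance : MeasurableSpace Ω) :=
  iSup₂_le fun j _ => (hY j).comap_le

lemma indepFun_id_sigmaWithout (hY : ∀ i, Measurable (Y i)) (hindep : iIndepFun Y P)
    (k : Fin n) : @IndepFun Ω Ω 𝒴 _ (sigmaWithout Y k) _ id (Y k) P := by
  rw [@IndepFun_iff_Indep Ω Ω 𝒴 _ (sigmaWithout Y k) _ id (Y k) P, MeasurableSpace.comap_id]
  have h := indep_iSup_of_disjoint (fun i => (hY i).comap_le) hindep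
    (S := {j | j ≠ k}) (T := {k}) (by simp)
  simpa using h

variable [IsProbabilityMeasure P]

/-- The section of a function `D` of `Y` in the coordinate `k`, the other coordinates being those
of `Y`, has the conditional law of `D(Y)` given these other coordinates. -/
lemma condLaw_ae_eq (hY : ∀ i, Measurable (Y i)) (hindep : iIndepFun Y P) (k : Fin n)
    {D : (Fin n → 𝒴) → ℝ} (hD : Measurable D) :
    ∀ᵐ ω ∂P, condLaw (sigmaWithout Y k) (fun ω => D fun j => Y j ω) P ω =
      (P.map (Y k)).map (fun x => D (Function.update (fun j => Y j ω) k x)) := by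
  have h := @condDistrib_ae_eq_of_indepFun Ω Ω 𝒴 _ (sigmaWithout Y k) _ P _ id (Y k)
    (measurable_id'' (sigmaWithout_le hY k)) (hY k) (indepFun_id_sigmaWithout hY hindep k)
    (fun p => D (Function.update (fun j => Y j p.1) k p.2))
    (hD.comp (measurable_update_sigmaWithout k))
  have e : (fun ω => D (Function.update (fun j => Y j ω) k (Y k ω))) =
      fun ω => D fun j => Y j ω := by
    funext ω
    rw [Function.update_eq_self k (fun j => Y j ω)]
  simp only [id] at h
  rw [e] at h
  exact h

lemma condExp_sq_ae_eq_integral (hY : ∀ i, Measurable (Y i)) (hindep : iIndepFun Y P) (k : Fin n)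
    {D : (Fin n → 𝒴) → ℝ} (hD : Measurable D)
    (hi : Integrable (fun ω => D (fun j => Y j ω) ^ 2) P) :
    ∀ᵐ ω ∂P, P[fun ω => D (fun j => Y j ω) ^ 2 | sigmaWithout Y k] ω =
      ∫ s, s ^ 2 ∂(P.map (Y k)).map (fun x => D (Function.update (fun j => Y j ω) k x)) := by
  have hDY : Measurable fun ω => D fun j => Y j ω := hD.comp (measurable_pi_lambda _ hY)
  have h := @condExp_ae_eq_integral_condDistrib Ω Ω ℝ ℝ _ _ _ _ _ P _ id
    (fun ω => D fun j => Y j ω) (sigmaWithout Y k) _ _ (measurable_id'' (sigmaWithout_le hY k))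
    hDY.aemeasurable (fun s => s ^ 2) (by fun_prop) hi
  rw [MeasurableSpace.comap_id] at h
  filter_upwards [h, condLaw_ae_eq hY hindep k hD] with ω h1 h2
  rw [h1, ← h2]
  rfl

lemma map_eq_pi (hY : ∀ i, Measurable (Y i)) (hindep : iIndepFun Y P) :
    P.map (fun ω j => Y j ω) = Measure.pi fun i => P.map (Y i) :=
  (iIndepFun_iff_map_fun_eq_pi_map fun i => (hY i).aemeasurable).1 hindep

lemma diffVar_eq (hY : ∀ i, Measurable (Y i)) (hindep : iIndepFun Y P)
    {f : (Fin n → 𝒴) → ℝ} (hf : Measurable f) (k : Fin n) :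
    diffVar P Y f k = fun ω => (fun y => f y - coordMean (fun i => P.map (Y i)) k f y)
      fun j => Y j ω := by
  have : ∀ i, IsProbabilityMeasure (P.map (Y i)) := fun i =>
    Measure.isProbabilityMeasure_map (hY i).aemeasurable
  funext ω
  rw [diffVar, centered, map_eq_pi hY hindep]
  congr 1
  have h := (measurePreserving_eval (fun i => P.map (Y i)) k).map_eq
  have hu : Measurable fun x => f (Function.update (fun j => Y j ω) k x) :=
    measurable_comp_update hf k _
  simp only [coordMean]
  rw [← h, integral_map (measurable_pi_apply k).aemeasurable hu.aestronglyMeasurable]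

end Coordinates

/-! ### The deviation bounds -/

section Main

variable {Ω 𝒴 : Type*} [MeasurableSpace Ω] [MeasurableSpace 𝒴] {P : Measure Ω}
  [IsProbabilityMeasure P] {n : ℕ} {Y : Fin n → Ω → 𝒴}

lemma measurable_lintegral_section {ν : Fin n → Measure 𝒴} [∀ i, IsProbabilityMeasure (ν i)]
    {f : (Fin n → 𝒴) → ℝ} (hf : Measurable f) (k : Fin n) {g : ℝ → ℝ≥0∞} (hg : Measurable g) :
    Measurable fun y => ∫⁻ x, g (f (Function.update y k x) - coordMean ν k f y) ∂ν k :=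
  (hg.comp ((hf.comp (measurable_update_prod k)).sub
    ((measurable_coordMean k hf).comp measurable_fst))).lintegral_prod_right'

/-- The cumulant bound for `f(Y)`. Almost surely the conditional laws are those of the coordinate
sections of `f`, so that the hypotheses on the conditional Orlicz norms and variances bound the
entropies of the sections. -/
theorem cgf_le_of_diffOrlicz_le (hY : ∀ i, Measurable (Y i)) (hindep : iIndepFun Y P)
    {f : (Fin n → 𝒴) → ℝ} (hf : Measurable f) (hint : Integrable (fun ω => f (fun j => Y j ω)) P)
    {α K U σ : ℝ} (hα : 1 ≤ α) (hK : 0 < K) (hKU : K ≤ U) (hσ : 0 < σ)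
    (hmax : ∀ᵐ ω ∂P, ∀ k, diffOrlicz P α Y f k ω ≤ ENNReal.ofReal K)
    (hsumU : ∀ᵐ ω ∂P, ∑ k, diffOrlicz P α Y f k ω ^ 2 ≤ ENNReal.ofReal (U ^ 2))
    (hsumσ : ∀ᵐ ω ∂P, ∑ k, diffVariance P Y f k ω ≤ σ ^ 2) {l : ℝ} (hl : 0 < l)
    (hlM : l * (zParam U σ α * K) ≤ α * zParam U σ α ^ α / 2) :
    l ∈ integrableExpSet (fun ω => f (fun j => Y j ω)) P ∧
      cgf (fun ω => f (fun j => Y j ω)) P l ≤ l * ∫ ω, f (fun j => Y j ω) ∂P +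
        σ ^ 2 / (zParam U σ α * K) ^ 2 * ((1 + 5 / 12 * (l * (zParam U σ α * K))) *
          expPhi (l * (zParam U σ α * K))) := by
  obtain ⟨-, hB4, hz, -⟩ := four_le_zParam_rpow hα U σ
  set z := zParam U σ α with hz_def
  have hM0 : 0 < z * K := mul_pos hz hK
  set θ := α * z ^ α / (z * K) with hθ_def
  have hθ : 0 < θ := by positivity
  set C := Real.exp (α * z ^ α) * 2 with hC_def
  have hprob : ∀ i, IsProbabilityMeasure (P.map (Y i)) := fun i =>
    Measure.isProbabilityMeasure_map (hY i).aemeasurable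
  set μ : Fin n → Measure 𝒴 := fun i => P.map (Y i) with hμ
  have hYm : Measurable fun ω j => Y j ω := measurable_pi_lambda _ hY
  have hmap : P.map (fun ω j => Y j ω) = Measure.pi μ := map_eq_pi hY hindep
  set D : Fin n → (Fin n → 𝒴) → ℝ := fun k y => f y - coordMean μ k f y with hD
  have hDm : ∀ k, Measurable (D k) := fun k => hf.sub (measurable_coordMean k hf)
  set ν : Fin n → Ω → Measure ℝ := fun k ω =>
    (μ k).map (fun x => D k (Function.update (fun j => Y j ω) k x)) with hν
  have hνp : ∀ k ω, IsProbabilityMeasure (ν k ω) := fun k ω =>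
    Measure.isProbabilityMeasure_map (measurable_comp_update (hDm k) k _).aemeasurable
  have hνl : ∀ k ω {g : ℝ → ℝ≥0∞}, Measurable g → ∫⁻ s, g s ∂ν k ω =
      ∫⁻ x, g (f (Function.update (fun j => Y j ω) k x) -
        coordMean μ k f (fun j => Y j ω)) ∂μ k := by
    intro k ω g hg
    rw [hν, lintegral_map hg (measurable_comp_update (hDm k) k _)]
    simp [hD]
  have hor : ∀ᵐ ω ∂P, ∀ k, diffOrlicz P α Y f k ω = orliczNorm α (ν k ω) := by
    rw [ae_all_iff]
    intro k
    filter_upwards [condLaw_ae_eq hY hindep k (hDm k)] with ω hω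
    rw [diffOrlicz, condOrliczNorm, diffVar_eq hY hindep hf k]
    exact congrArg _ hω
  have hexpm : Measurable fun s : ℝ => ENNReal.ofReal (Real.exp (θ * |s|)) := by fun_prop
  have hsqm : Measurable fun s : ℝ => ENNReal.ofReal (s ^ 2) := by fun_prop
  have hexp : ∀ᵐ ω ∂P, ∀ k, ∫⁻ s, ENNReal.ofReal (Real.exp (θ * |s|)) ∂ν k ω ≤
      ENNReal.ofReal C := by
    filter_upwards [hmax, hor] with ω h1 h2 k
    exact lintegral_exp_mul_abs_le hα hz hK (h2 k ▸ h1 k)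
  have hsqle : ∀ s : ℝ, s ^ 2 ≤ 2 / θ ^ 2 * Real.exp (θ * |s|) := by
    intro s
    have h := Real.quadratic_le_exp_of_nonneg (x := θ * |s|) (by positivity)
    have h2 : (θ * |s|) ^ 2 = s ^ 2 * θ ^ 2 := by rw [mul_pow, sq_abs]; ring
    have h3 : 0 ≤ θ * |s| := by positivity
    rw [div_mul_eq_mul_div, le_div_iff₀ (by positivity)]
    nlinarith
  have hsqfin : ∀ᵐ ω ∂P, ∀ k, ∫⁻ s, ENNReal.ofReal (s ^ 2) ∂ν k ω ≤
      ENNReal.ofReal (2 / θ ^ 2 * C) := by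
    filter_upwards [hexp] with ω h k
    calc ∫⁻ s, ENNReal.ofReal (s ^ 2) ∂ν k ω
        ≤ ∫⁻ s, ENNReal.ofReal (2 / θ ^ 2) * ENNReal.ofReal (Real.exp (θ * |s|)) ∂ν k ω := by
          refine lintegral_mono fun s => ?_
          rw [← ENNReal.ofReal_mul (by positivity)]
          exact ENNReal.ofReal_le_ofReal (hsqle s)
      _ ≤ ENNReal.ofReal (2 / θ ^ 2) * ENNReal.ofReal C := by
          rw [lintegral_const_mul' _ _ ENNReal.ofReal_ne_top]
          gcongr
          exact h k
      _ = _ := by rw [← ENNReal.ofReal_mul (by positivity)]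
  -- the conditional variances are those of the sections, which are square integrable
  have hsqint : ∀ k, Integrable (fun ω => D k (fun j => Y j ω) ^ 2) P := by
    intro k
    refine ⟨(((hDm k).comp hYm).pow_const 2).aestronglyMeasurable, ?_⟩
    rw [hasFiniteIntegral_iff_ofReal (.of_forall fun _ => sq_nonneg _)]
    have hg : Measurable fun y => ENNReal.ofReal (D k y ^ 2) := hsqm.comp (hDm k)
    calc ∫⁻ ω, ENNReal.ofReal (D k (fun j => Y j ω) ^ 2) ∂P
        = ∫⁻ y, ENNReal.ofReal (D k y ^ 2) ∂Measure.pi μ := by rw [← hmap, lintegral_map hg hYm]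
      _ = ∫⁻ y, ∫⁻ x, ENNReal.ofReal (D k (Function.update y k x) ^ 2) ∂μ k ∂Measure.pi μ :=
          (lintegral_lintegral_update k hg).symm
      _ = ∫⁻ ω, ∫⁻ s, ENNReal.ofReal (s ^ 2) ∂ν k ω ∂P := by
          rw [← hmap, lintegral_map _ hYm]
          · refine lintegral_congr fun ω => ?_
            rw [hν, lintegral_map hsqm (measurable_comp_update (hDm k) k _)]
          · exact (hg.comp (measurable_update_prod k)).lintegral_prod_right'
      _ ≤ ∫⁻ _, ENNReal.ofReal (2 / θ ^ 2 * C) ∂P :=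
          lintegral_mono_ae (hsqfin.mono fun ω h => h k)
      _ < ∞ := by simp
  have hvar : ∀ᵐ ω ∂P, ∀ k, diffVariance P Y f k ω = ∫ s, s ^ 2 ∂ν k ω := by
    rw [ae_all_iff]
    intro k
    filter_upwards [condExp_sq_ae_eq_integral hY hindep k (hDm k) (hsqint k)] with ω hω
    rw [diffVariance, diffVar_eq hY hindep hf k]
    exact hω
  have hsumσ' : ∀ᵐ ω ∂P, ∑ k, ∫⁻ s, ENNReal.ofReal (s ^ 2) ∂ν k ω ≤ ENNReal.ofReal (σ ^ 2) := by
    filter_upwards [hsumσ, hvar, hsqfin] with ω h1 h2 h3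
    have h4 : ∀ k, ∫⁻ s, ENNReal.ofReal (s ^ 2) ∂ν k ω =
        ENNReal.ofReal (∫ s, s ^ 2 ∂ν k ω) := fun k => by
      refine (ofReal_integral_eq_lintegral_ofReal ⟨by fun_prop, ?_⟩
        (.of_forall fun s => sq_nonneg s)).symm
      rw [hasFiniteIntegral_iff_ofReal (.of_forall fun _ => sq_nonneg _)]
      exact (h3 k).trans_lt ENNReal.ofReal_lt_top
    rw [Finset.sum_congr rfl fun k _ => h4 k, ← ENNReal.ofReal_sum_of_nonneg
      fun k _ => integral_nonneg fun s => sq_nonneg s]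
    refine ENNReal.ofReal_le_ofReal ?_
    rwa [← Finset.sum_congr rfl fun k _ => h2 k]
  -- transfer to the product space
  have hCpi : ∀ k, ∀ᵐ y ∂Measure.pi μ, ∫⁻ x, ENNReal.ofReal
      (Real.exp (θ * |f (Function.update y k x) - coordMean μ k f y|)) ∂μ k ≤
        ENNReal.ofReal C := by
    intro k
    rw [← hmap, ae_map_iff hYm.aemeasurable
      (measurableSet_le (measurable_lintegral_section hf k hexpm) measurable_const)]
    filter_upwards [hexp] with ω h
    rw [← hνl k ω hexpm]
    exact h k
  have hGpi : ∀ t ∈ Set.Ioc 0 l, ∀ᵐ y ∂Measure.pi μ, ∑ k, ∫⁻ x, ENNReal.ofReal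
      (entPsi (t * (f (Function.update y k x) - coordMean μ k f y))) ∂μ k ≤
        ENNReal.ofReal (σ ^ 2 / (z * K) ^ 2 *
          ((1 + 5 / 12 * (t * (z * K))) * entPsi (t * (z * K)))) := by
    intro t ht
    have hψm : Measurable fun s : ℝ => ENNReal.ofReal (entPsi (t * s)) :=
      (measurable_entPsi.comp (measurable_const_mul t)).ennreal_ofReal
    rw [← hmap, ae_map_iff hYm.aemeasurable (measurableSet_le
      (Finset.measurable_sum _ fun k _ => measurable_lintegral_section hf k hψm)
        measurable_const)]
    filter_upwards [hmax, hsumU, hsumσ', hor] with ω h1 h2 h3 h4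
    rw [Finset.sum_congr rfl fun k _ => (hνl k ω hψm).symm]
    simp only [h4] at h1 h2
    refine sum_lintegral_entPsi_le hα hK hKU hσ h1 h2 h3 ht.1 (le_trans ?_ hlM)
    exact mul_le_mul_of_nonneg_right ht.2 hM0.le
  have hFi : Integrable f (Measure.pi μ) := by
    rw [← hmap, integrable_map_measure hf.aestronglyMeasurable hYm.aemeasurable]
    exact hint
  have hlθ : l < θ := by
    rw [hθ_def, lt_div_iff₀ hM0]
    have : 0 < α * z ^ α := by positivity
    linarith
  obtain ⟨h1, h2⟩ := cgf_le_bennett hf hFi (v := σ ^ 2 / (z * K) ^ 2) hM0.le (by positivity)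
    hCpi hl hlθ hGpi
  have hexpf : Measurable fun y => Real.exp (l * f y) := by fun_prop
  constructor
  · have h := integrable_of_mem_integrableExpSet h1
    rw [← hmap, integrable_map_measure hexpf.aestronglyMeasurable hYm.aemeasurable] at h
    exact h
  · have e1 : cgf f (Measure.pi μ) l = cgf (fun ω => f (fun j => Y j ω)) P l := by
      simp only [cgf, mgf]
      rw [← hmap, integral_map hYm.aemeasurable hexpf.aestronglyMeasurable]
    have e2 : ∫ y, f y ∂Measure.pi μ = ∫ ω, f (fun j => Y j ω) ∂P := by
      rw [← hmap, integral_map hYm.aemeasurable hf.aestronglyMeasurable]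
    rw [e1, e2] at h2
    exact h2

/-- The two deviation bounds for `K > 0`. -/
theorem deviation_of_diffOrlicz_le (hY : ∀ i, Measurable (Y i)) (hindep : iIndepFun Y P)
    {f : (Fin n → 𝒴) → ℝ} (hf : Measurable f) (hint : Integrable (fun ω => f (fun j => Y j ω)) P)
    {α K U σ x : ℝ} (hα : 1 ≤ α) (hK : 0 < K) (hKU : K ≤ U) (hσ : 0 < σ) (hx : 0 < x)
    (hmax : ∀ᵐ ω ∂P, ∀ k, diffOrlicz P α Y f k ω ≤ ENNReal.ofReal K)
    (hsumU : ∀ᵐ ω ∂P, ∑ k, diffOrlicz P α Y f k ω ^ 2 ≤ ENNReal.ofReal (U ^ 2))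
    (hsumσ : ∀ᵐ ω ∂P, ∑ k, diffVariance P Y f k ω ≤ σ ^ 2) :
    1 - Real.exp (-x) ≤ P.real {ω | f (fun j => Y j ω) - ∫ ω', f (fun j => Y j ω') ∂P ≤
        σ * Real.sqrt (2 * x) + 3 / 4 * (zParam U σ α * K) * x} ∧
      ∀ q, 16 / 3 ≤ q → q ≤ 2 * α * zParam U σ α ^ α →
        Real.exp q ≤ (zParam U σ α * K / σ) ^ 2 * x →
        1 - Real.exp (-x) ≤ P.real {ω | f (fun j => Y j ω) - ∫ ω', f (fun j => Y j ω') ∂P ≤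
          σ * Real.sqrt (2 * x) + 4 * (zParam U σ α * K) * x / q} := by
  obtain ⟨-, hB4, hz, -⟩ := four_le_zParam_rpow hα U σ
  obtain ⟨h1, h2⟩ := deviation_of_cgf_le (W := fun ω => f (fun j => Y j ω))
    (c := α * zParam U σ α ^ α / 2) (hf.comp (measurable_pi_lambda _ hY))
    (mul_pos hz hK) hσ hx (by nlinarith)
    (fun l hl hlM => cgf_le_of_diffOrlicz_le hY hindep hf hint hα hK hKU hσ hmax hsumU hsumσ
      hl hlM)
  exact ⟨h1, fun q hq hqB hqe => h2 q hq (by linarith) hqe⟩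

/-- If all conditional Orlicz norms vanish, the linear term vanishes: the bound for small positive
`K` is taken to the limit by right continuity of distribution functions. -/
theorem deviation_of_diffOrlicz_eq_zero (hY : ∀ i, Measurable (Y i)) (hindep : iIndepFun Y P)
    {f : (Fin n → 𝒴) → ℝ} (hf : Measurable f) (hint : Integrable (fun ω => f (fun j => Y j ω)) P)
    {α σ x : ℝ} (hα : 1 ≤ α) (hσ : 0 < σ) (hx : 0 < x)
    (hmax : ∀ᵐ ω ∂P, ∀ k, diffOrlicz P α Y f k ω ≤ 0)
    (hsumσ : ∀ᵐ ω ∂P, ∑ k, diffVariance P Y f k ω ≤ σ ^ 2) :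
    1 - Real.exp (-x) ≤ P.real {ω | f (fun j => Y j ω) - ∫ ω', f (fun j => Y j ω') ∂P ≤
        σ * Real.sqrt (2 * x)} := by
  set W : Ω → ℝ := fun ω => f (fun j => Y j ω) - ∫ ω', f (fun j => Y j ω') ∂P with hW_def
  have hW : Measurable W := (hf.comp (measurable_pi_lambda _ hY)).sub_const _
  have hp : IsProbabilityMeasure (P.map W) := Measure.isProbabilityMeasure_map hW.aemeasurable
  have hcdf : ∀ s, cdf (P.map W) s = P.real {ω | W ω ≤ s} := fun s => by
    rw [cdf_eq_real, map_measureReal_apply hW measurableSet_Iic]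
    rfl
  rw [← hcdf]
  set s := σ * Real.sqrt (2 * x) with hs
  set c := 3 / 4 * zParam 1 σ α * x with hc
  have hc0 : 0 < c := by
    have := (four_le_zParam_rpow hα 1 σ).2.2.1
    positivity
  have hlim : Filter.Tendsto (fun j : ℕ => cdf (P.map W) (s + c * (1 / ((j : ℝ) + 1))))
      Filter.atTop (nhds (cdf (P.map W) s)) := by
    refine Filter.Tendsto.comp ((cdf (P.map W)).right_continuous s) ?_
    refine tendsto_nhdsWithin_iff.2 ⟨?_, .of_forall fun j => ?_⟩
    · have := ((tendsto_one_div_add_atTop_nhds_zero_nat (𝕜 := ℝ)).const_mul c).const_add s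
      simpa using this
    · have : 0 < 1 / ((j : ℝ) + 1) := Nat.one_div_pos_of_nat
      have h2 : 0 ≤ c * (1 / ((j : ℝ) + 1)) := by positivity
      exact Set.mem_Ici.2 (by linarith)
  refine ge_of_tendsto' hlim fun j => ?_
  have hj0 : 0 < 1 / ((j : ℝ) + 1) := Nat.one_div_pos_of_nat
  have hj1 : 1 / ((j : ℝ) + 1) ≤ 1 := by
    rw [div_le_one (by positivity)]
    have : (0 : ℝ) ≤ j := j.cast_nonneg
    linarith
  have h := (deviation_of_diffOrlicz_le hY hindep hf hint hα hj0 hj1 hσ hx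
    (hmax.mono fun ω h k => (h k).trans bot_le)
    (hmax.mono fun ω h => by
      have : ∀ k, diffOrlicz P α Y f k ω = 0 := fun k => le_antisymm (h k) bot_le
      simp [this]) hsumσ).1
  rw [hcdf]
  refine h.trans (le_of_eq ?_)
  congr 3
  ext ω
  rw [hc, hW_def, hs]
  ring_nf

end Main

end McDiarmid

theorem mainTheorem5
    {Ω 𝒴 : Type*} [MeasurableSpace Ω] [MeasurableSpace 𝒴]
    (P : Measure Ω) [IsProbabilityMeasure P]
    (n : ℕ) (hn : 1 ≤ n)
    (Y : Fin n → Ω → 𝒴) (hY : ∀ i, Measurable (Y i)) (hindep : iIndepFun Y P)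
    (f : (Fin n → 𝒴) → ℝ) (hf : Measurable f)
    (hint : Integrable (fun ω => f (fun j => Y j ω)) P)
    (α K U σ x : ℝ) (hα : 1 ≤ α) (hK : 0 ≤ K) (hKU : K ≤ U) (hσ : 0 < σ) (hx : 0 < x)
    (hmax : ∀ᵐ ω ∂P, ∀ k, McDiarmid.diffOrlicz P α Y f k ω ≤ ENNReal.ofReal K)
    (hsumU : ∀ᵐ ω ∂P, ∑ k, McDiarmid.diffOrlicz P α Y f k ω ^ 2 ≤ ENNReal.ofReal (U ^ 2))
    (hsumσ : ∀ᵐ ω ∂P, ∑ k, McDiarmid.diffVariance P Y f k ω ≤ σ ^ 2) :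
    1 - Real.exp (-x) ≤ P.real {ω | f (fun j => Y j ω) - ∫ ω', f (fun j => Y j ω') ∂P ≤
        σ * Real.sqrt (2 * x * ((n + 1) / n)) +
          4 * K * McDiarmid.zParam U σ α * x /
            min (2 * α * McDiarmid.zParam U σ α ^ α)
              (McDiarmid.ulog
                ((K * McDiarmid.zParam U σ α / (σ * ((n + 1) / n))) ^ 2 * x))} ∧
    1 - Real.exp (-x) ≤ P.real {ω | f (fun j => Y j ω) - ∫ ω', f (fun j => Y j ω') ∂P ≤
        σ * Real.sqrt (2 * x * ((n + 1) / n)) +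
          3 / 4 * K * McDiarmid.zParam U σ α * x * ((n + 1) / n)} := by
  obtain ⟨-, hB4, hz, -⟩ := McDiarmid.four_le_zParam_rpow hα U σ
  set z := McDiarmid.zParam U σ α with hz_def
  have hn0 : (0 : ℝ) < n := by exact_mod_cast hn
  set c : ℝ := ((n : ℝ) + 1) / n with hc
  -- the bounds hold with `c` replaced by one, and they are monotone in `c`
  have hc1 : 1 ≤ c := by rw [hc, one_le_div hn0]; linarith
  have hsqrt : σ * Real.sqrt (2 * x) ≤ σ * Real.sqrt (2 * x * c) :=
    mul_le_mul_of_nonneg_left (Real.sqrt_le_sqrt (le_mul_of_one_le_right (by positivity) hc1)) hσ.le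
  have hmono : ∀ {a b : ℝ}, a ≤ b →
      1 - Real.exp (-x) ≤ P.real {ω | f (fun j => Y j ω) - ∫ ω', f (fun j => Y j ω') ∂P ≤ a} →
      1 - Real.exp (-x) ≤ P.real {ω | f (fun j => Y j ω) - ∫ ω', f (fun j => Y j ω') ∂P ≤ b} :=
    fun hab h => h.trans (measureReal_mono fun ω hω => le_trans hω hab)
  rcases hK.eq_or_lt with hK0 | hK0
  · have h := McDiarmid.deviation_of_diffOrlicz_eq_zero hY hindep hf hint hα hσ hx
      (by simpa [← hK0] using hmax) hsumσ
    rw [← hK0]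
    exact ⟨hmono (by simpa using hsqrt) h, hmono (by simpa using hsqrt) h⟩
  obtain ⟨h1, h2⟩ := McDiarmid.deviation_of_diffOrlicz_le hY hindep hf hint hα hK0 hKU hσ hx hmax
    hsumU hsumσ
  refine ⟨?_, hmono ?_ h1⟩
  · set q := min (2 * α * z ^ α) (McDiarmid.ulog ((K * z / (σ * c)) ^ 2 * x)) with hq
    have hq0 : 0 < q := by
      refine lt_min (by positivity) (lt_of_lt_of_le one_pos (le_max_right _ _))
    -- for `q ≤ 16 / 3` the slope `4 / q` is at least the slope `3 / 4` of the second bound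
    rcases le_or_gt q (16 / 3) with hq1 | hq1
    · refine hmono (add_le_add hsqrt ?_) h1
      rw [le_div_iff₀ hq0]
      have : 0 < K * z * x := by positivity
      nlinarith
    · refine hmono (add_le_add hsqrt (le_of_eq ?_)) (h2 q hq1.le (min_le_left _ _) ?_)
      · ring
      · have hq2 : q ≤ Real.log ((K * z / (σ * c)) ^ 2 * x) := by
          have h3 : q ≤ max (Real.log ((K * z / (σ * c)) ^ 2 * x)) 1 := min_le_right _ _
          exact (le_max_iff.1 h3).resolve_right (by linarith)
        have hpos : 0 < (K * z / (σ * c)) ^ 2 * x := by positivity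
        calc Real.exp q ≤ (K * z / (σ * c)) ^ 2 * x := by
              rwa [← Real.le_log_iff_exp_le hpos]
          _ ≤ (z * K / σ) ^ 2 * x := by
              rw [mul_comm K z]
              gcongr
              exact le_mul_of_one_le_right hσ.le hc1
  · refine add_le_add hsqrt ?_
    calc 3 / 4 * (z * K) * x = 3 / 4 * K * z * x := by ring
      _ ≤ 3 / 4 * K * z * x * c := le_mul_of_one_le_right (by positivity) hc1
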